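/- Let $\mathcal H$ be a nonzero complex Hilbert space and let $S(t)=e^{tA}$, $t\ge 0$, be a strongly continuous semigroup of bounded linear operators on $\mathcal H$ with $S(0)=I$ and generator $A$. Let $m:[0,\infty)\to(0,\infty)$ be continuous with $\|S(t)\|\le m(t)$ for all $t\ge 0$. Let $\omega\in\mathbb R$ be such that the half-plane $\{\operatorname{Re} z>\omega\}$ is contained in the resolvent set of $A$ and $\|(z-A)^{-1}\|$ is bounded there, and define $r(\omega)>0$ by $$\frac1{r(\omega)}=\sup_{\operatorname{Re} z>\omega}\|(z-A)^{-1}\|.$$ Let $\Phi,\Psi\in C^1([0,\infty);\mathbb R)$ satisfy $\Phi(0)=\Psi(0)=0$ and $\Phi(t)>0$, $\Psi(t)>0$ for $t>0$, and let $\epsilon_1,\epsilon_2\in\{+,-\}$. For $a\in\mathbb R$ write $a_+=\max(a,0)$ and $a_-=\max(-a,0)$; for $t>0$ write $\iota_t u(s)=u(t-s)$ and $$\|f\|_{e^{\omega\cdot}L^2([0,t))}=\Big(\int_0^t e^{-2\omega s}|f(s)|^2\,ds\Big)^{1/2}.$$ Then for every $t>0$ for which the denominator below is positive, $$\|S(t)\|_{\mathcal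 L(\mathcal H)}\le e^{\omega t}\,\frac{\big\|(r(\omega)^2\Phi^2-\Phi'^2)_-^{1/2}\,m\big\|_{e^{\omega\cdot}L^2([0,t))}\;\big\|(r(\omega)^2\Psi^2-\Psi'^2)_-^{1/2}\,m\big\|_{e^{\omega\cdot}L^2([0,t))}}{\displaystyle\int_0^t (r(\omega)^2\Phi^2-\Phi'^2)_{\epsilon_1}^{1/2}\,\big(r(\omega)^2(\iota_t\Psi)^2-(\iota_t\Psi')^2\big)_{\epsilon_2}^{1/2}\,ds}.$$ -/

import Mathlib

open Filter Topology

noncomputable section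

namespace GearhartPruss

variable {H : Type*} [NormedAddCommGroup H] [InnerProductSpace ℂ H]

/-- `S : [0, ∞) → L(H)` is a strongly continuous semigroup with `S 0 = I`.
The values of `S` at negative arguments are irrelevant. -/
structure IsC0Semigroup (S : ℝ → H →L[ℂ] H) : Prop where
  map_zero : S 0 = ContinuousLinearMap.id ℂ H
  map_add : ∀ s t : ℝ, 0 ≤ s → 0 ≤ t → S (s + t) = (S s).comp (S t)
  strong_continuity : ∀ x : H, ContinuousOn (fun t => S t x) (Set.Ici 0)

/-- `(S h x - x) / h`. -/
def diffQuot (S : ℝ → H →L[ℂ] H) (x : H) (h : ℝ) : H :=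
  ((h⁻¹ : ℝ) : ℂ) • (S h x - x)

theorem diffQuot_add (S : ℝ → H →L[ℂ] H) (x y : H) :
    diffQuot S (x + y) = fun h => diffQuot S x h + diffQuot S y h := by
  funext h
  simp only [diffQuot, map_add, ← smul_add]
  congr 1
  abel

theorem diffQuot_smul (S : ℝ → H →L[ℂ] H) (c : ℂ) (x : H) :
    diffQuot S (c • x) = fun h => c • diffQuot S x h := by
  funext h
  simp only [diffQuot, map_smul, ← smul_sub]
  rw [smul_comm]

/-- The domain of the generator: those `x` for which `(S h x - x) / h` converges as `h → 0+`. -/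
def generatorDomain (S : ℝ → H →L[ℂ] H) : Submodule ℂ H where
  carrier := {x | ∃ y, Tendsto (diffQuot S x) (𝓝[>] 0) (𝓝 y)}
  zero_mem' := ⟨0, by
    have : diffQuot S 0 = fun _ => 0 := by funext h; simp [diffQuot]
    rw [this]
    exact tendsto_const_nhds⟩
  add_mem' := by
    rintro x y ⟨a, ha⟩ ⟨b, hb⟩
    exact ⟨a + b, by rw [diffQuot_add]; exact ha.add hb⟩
  smul_mem' := by
    rintro c x ⟨a, ha⟩
    exact ⟨c • a, by rw [diffQuot_smul]; exact ha.const_smul c⟩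

/-- The generator `A` of `S`, an unbounded operator: `A x = lim_{h → 0+} (S h x - x) / h`. -/
def generator (S : ℝ → H →L[ℂ] H) : H →ₗ.[ℂ] H where
  domain := generatorDomain S
  toFun :=
    { toFun := fun x => Classical.choose x.2
      map_add' := fun x y => by
        refine tendsto_nhds_unique (Classical.choose_spec (x + y).2) ?_
        have h := (Classical.choose_spec x.2).add (Classical.choose_spec y.2)
        rw [Submodule.coe_add, diffQuot_add]
        exact h
      map_smul' := fun c x => by
        refine tendsto_nhds_unique (Classical.choose_spec (c • x).2) ?_
        have h := (Classical.choose_spec x.2).const_smul c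
        rw [Submodule.coe_smul, diffQuot_smul]
        exact h }

/-- `R` is the bounded two-sided inverse of `z - A : D(A) → H`. -/
def IsResolventAt (A : H →ₗ.[ℂ] H) (z : ℂ) (R : H →L[ℂ] H) : Prop :=
  (∀ y : H, ∃ hy : R y ∈ A.domain, z • R y - A ⟨R y, hy⟩ = y) ∧
    ∀ x : A.domain, R (z • (x : H) - A x) = x

/-- The resolvent set `ρ(A)`. -/
def resolventSet (A : H →ₗ.[ℂ] H) : Set ℂ :=
  {z | ∃ R : H →L[ℂ] H, IsResolventAt A z R}

open scoped Classical in
/-- `(z - A)⁻¹` for `z ∈ ρ(A)` (and `0` outside of `ρ(A)`). -/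
def resolvent (A : H →ₗ.[ℂ] H) (z : ℂ) : H →L[ℂ] H :=
  if h : ∃ R : H →L[ℂ] H, IsResolventAt A z R then Classical.choose h else 0

/-- The open half-plane `Re z > ω` lies in `ρ(A)`, and `‖(z - A)⁻¹‖` is bounded there. -/
structure ResolventBoundedRightOf (A : H →ₗ.[ℂ] H) (ω : ℝ) : Prop where
  subset_resolventSet : {z : ℂ | ω < z.re} ⊆ resolventSet A
  bounded : ∃ C : ℝ, ∀ z : ℂ, ω < z.re → ‖resolvent A z‖ ≤ C

/-- `r(ω)`, defined by `1 / r(ω) = sup_{Re z > ω} ‖(z - A)⁻¹‖`. -/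
def resolventRadius (A : H →ₗ.[ℂ] H) (ω : ℝ) : ℝ :=
  (sSup ((fun z : ℂ => ‖resolvent A z‖) '' {z : ℂ | ω < z.re}))⁻¹

/-- `Φ ∈ C¹([0, ∞))`, `Φ(0) = 0` and `Φ(t) > 0` for `t > 0`. -/
structure IsAdmissible (Φ : ℝ → ℝ) : Prop where
  contDiffOn : ContDiffOn ℝ 1 Φ (Set.Ici 0)
  map_zero : Φ 0 = 0
  pos : ∀ t, 0 < t → 0 < Φ t

/-- The derivative of a function on `[0, ∞)` (one-sided at `0`). -/
def halfLineDeriv (Φ : ℝ → ℝ) : ℝ → ℝ := derivWithin Φ (Set.Ici 0)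

/-- The reflection `ι_t u (s) = u (t - s)`. -/
def reflect (t : ℝ) (u : ℝ → ℝ) : ℝ → ℝ := fun s => u (t - s)

/-- A sign `+` or `-`. -/
inductive PM where
  | plus
  | minus

/-- `a_+ = max (a, 0)` and `a_- = max (-a, 0)`. -/
def PM.part : PM → ℝ → ℝ
  | .plus, a => max a 0
  | .minus, a => max (-a) 0

/-- The norm of `e^{ω ·} L²([0, t))`, i.e. the `L²([0, t))` norm of `s ↦ e^{-ω s} f(s)`. -/
def weightedL2Norm (ω t : ℝ) (f : ℝ → ℝ) : ℝ :=
  Real.sqrt (∫ s in Set.Ico 0 t, (Real.exp (-ω * s) * f s) ^ 2)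

end GearhartPruss

end

/-! Write `u(s) = S(s)x`. The function `Φu` vanishes at `0` and solves `(∂ₛ - A)v = Φ'u`. Laplace
transformation along `Re z = α` turns this into `(z - A)v̂ = (Φ'u)^`, and the resolvent bound `1/r`
with Plancherel in `H` gives `r² ∫ e^{-2αs} Φ² ‖u‖² ≤ ∫ e^{-2αs} Φ'² ‖u‖²`. Stopping `Φ` at time `t`
makes the estimate causal, so both integrals may be taken over `[0, t]` (`integral_weighted_sq_le`).

This needs `α` to the right of a growth exponent of `S`. The weight `sinh(γs)` in the same estimate
lowers any growth exponent by a fixed amount until `ω` is reached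
(`exists_growthBound_of_resolventEstimate`); then `α` decreases to `ω`. Thus `∫ (r²Φ² - Φ'²)
e^{-2ωs} ‖u‖² ≤ 0`: the positive part is dominated by the negative part, where `‖u‖ ≤ m ‖x‖`
(`integral_part_mul_orbit_sq_le`).

The adjoint semigroup satisfies the same hypotheses, so the same holds for `Ψ` along `S(s)*y` with
`y = S(t)x`. Since `‖y‖² = ⟨S(s)x, S(t-s)*y⟩` for every `s`, multiplying by the two weights,
integrating in `s` and applying Cauchy–Schwarz gives the theorem. -/

section Plancherel

/-! ### Plancherel for Hilbert-space-valued Fourier integrals. -/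

open MeasureTheory FourierTransform SchwartzMap

variable {F : Type*} [NormedAddCommGroup F] [InnerProductSpace ℂ F] [CompleteSpace F]

/-- For `f ∈ L¹ ∩ L²`, the Fourier transform of the class of `f` in `L²` is represented by the
Fourier integral of `f`. -/
theorem Lp_fourier_toLp_ae_eq {f : ℝ → F} (h1 : Integrable f volume) (h2 : MemLp f 2 volume) :
    ⇑(𝓕 (h2.toLp f) : Lp (α := ℝ) F 2 volume) =ᵐ[volume] 𝓕 f := by
  set g : Lp (α := ℝ) F 2 volume := 𝓕 (h2.toLp f) with hg
  have hcont : Continuous (𝓕 f) :=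
    VectorFourier.fourierIntegral_continuous Real.continuous_fourierChar
      (by fun_prop) h1
  have hgl : LocallyIntegrable (g : ℝ → F) :=
    (Lp.memLp g).locallyIntegrable one_le_two
  -- It suffices to test against compactly supported smooth functions. The `L²` transform agrees
  -- with the distributional one, and the multiplication formula moves `𝓕` between the test function
  -- and `f`.
  refine ae_eq_of_integral_contDiff_smul_eq hgl hcont.locallyIntegrable ?_
  intro φ hφ hφc
  let ψ : 𝓢(ℝ, ℂ) := HasCompactSupport.toSchwartzMap (f := fun x => ((φ x : ℝ) : ℂ))
    (hφc.comp_left (g := fun x : ℝ => (x : ℂ)) (by simp))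
    (Complex.ofRealCLM.contDiff.comp hφ)
  have hψ : ∀ x, ψ x = φ x := fun x => rfl
  have key := congrArg (fun T => T ψ) (Lp.fourier_toTemperedDistribution_eq (h2.toLp f))
  simp only [TemperedDistribution.fourier_apply, Lp.toTemperedDistribution_apply] at key
  have e1 : ∫ x, (𝓕 ψ) x • (h2.toLp f) x = ∫ x, (𝓕 ψ) x • f x := by
    refine integral_congr_ae ?_
    filter_upwards [h2.coeFn_toLp] with x hx
    rw [hx]
  have e2 : ∫ x, (𝓕 ψ) x • f x = ∫ x, ψ x • 𝓕 f x := by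
    have := VectorFourier.integral_fourierIntegral_smul_eq_flip (e := Real.fourierChar)
      (L := innerₗ ℝ) (μ := volume) (ν := volume) (f := ⇑ψ) (g := f)
      Real.continuous_fourierChar (by fun_prop) ψ.integrable h1
    rw [flip_innerₗ] at this
    exact this
  rw [e1, e2] at key
  simp only [hψ, Complex.coe_smul] at key
  exact key.symm

/-- **Plancherel's theorem** for the Fourier integral of a function in `L¹ ∩ L²`. -/
theorem eLpNorm_fourier_eq {f : ℝ → F} (h1 : Integrable f volume) (h2 : MemLp f 2 volume) :
    eLpNorm (𝓕 f) 2 volume = eLpNorm f 2 volume := by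
  rw [← eLpNorm_congr_ae (Lp_fourier_toLp_ae_eq h1 h2), ← Lp.enorm_def, ← ofReal_norm,
    Lp.norm_fourier_eq, ofReal_norm, Lp.enorm_def, eLpNorm_congr_ae h2.coeFn_toLp]

end Plancherel

namespace GearhartPruss

open MeasureTheory
open scoped InnerProductSpace

/-! ### Generator, resolvent and integrated semigroup. -/

section Basic

variable {H : Type*} [NormedAddCommGroup H] [InnerProductSpace ℂ H]

theorem IsC0Semigroup.apply_add {S : ℝ → H →L[ℂ] H} (hS : IsC0Semigroup S) {s t : ℝ}
    (hs : 0 ≤ s) (ht : 0 ≤ t) (x : H) : S (s + t) x = S s (S t x) := by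
  rw [hS.map_add s t hs ht]; rfl

/-- `S` is bounded by a continuous function on `[0, ∞)`. -/
def DominatedBy (S : ℝ → H →L[ℂ] H) (m : ℝ → ℝ) : Prop :=
  ContinuousOn m (Set.Ici 0) ∧ ∀ t, 0 ≤ t → ‖S t‖ ≤ m t

theorem DominatedBy.exists_bound {S : ℝ → H →L[ℂ] H} {m : ℝ → ℝ} (hm : DominatedBy S m)
    (T : ℝ) : ∃ M : ℝ, 1 ≤ M ∧ ∀ s, 0 ≤ s → s ≤ T → ‖S s‖ ≤ M := by
  obtain ⟨M, hM⟩ := (isCompact_Icc (a := (0 : ℝ)) (b := T)).exists_bound_of_continuousOn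
    (hm.1.mono Set.Icc_subset_Ici_self)
  refine ⟨max M 1, le_max_right _ _, fun s h0 hT => ?_⟩
  exact (hm.2 s h0).trans ((le_abs_self _).trans ((hM s ⟨h0, hT⟩).trans (le_max_left _ _)))

theorem tendsto_diffQuot_generator (S : ℝ → H →L[ℂ] H) (x : (generator S).domain) :
    Tendsto (diffQuot S x) (𝓝[>] 0) (𝓝 (generator S x)) :=
  Classical.choose_spec x.2

theorem generator_eq_of_tendsto {S : ℝ → H →L[ℂ] H} {x y : H}
    (h : Tendsto (diffQuot S x) (𝓝[>] 0) (𝓝 y)) :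
    ∃ hx : x ∈ (generator S).domain, generator S ⟨x, hx⟩ = y :=
  ⟨⟨y, h⟩, tendsto_nhds_unique (tendsto_diffQuot_generator S ⟨x, ⟨y, h⟩⟩) h⟩

theorem isResolventAt_resolvent {A : H →ₗ.[ℂ] H} {z : ℂ} (hz : z ∈ resolventSet A) :
    IsResolventAt A z (resolvent A z) := by
  have hz' : ∃ R : H →L[ℂ] H, IsResolventAt A z R := hz
  rw [resolvent, dif_pos hz']
  exact Classical.choose_spec hz'

/-- Whenever `(z - A) w = g` for the generator `A` of `S` and `Re z > ω`, one has
`‖w‖ ≤ K ‖g‖`. -/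
def ResolventEstimate (S : ℝ → H →L[ℂ] H) (ω K : ℝ) : Prop :=
  ∀ z : ℂ, ω < z.re → ∀ w g : H,
    Tendsto (diffQuot S w) (𝓝[>] 0) (𝓝 (z • w - g)) → ‖w‖ ≤ K * ‖g‖

theorem ResolventEstimate.mono {S : ℝ → H →L[ℂ] H} {ω ω' K : ℝ}
    (h : ResolventEstimate S ω K) (hω : ω ≤ ω') : ResolventEstimate S ω' K :=
  fun z hz => h z (hω.trans_lt hz)

/-- Only this a priori inequality is used later. Phrased through difference quotients, it also makes
sense for the adjoint semigroup without identifying its generator. -/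
theorem resolventEstimate_of_norm_resolvent_le {S : ℝ → H →L[ℂ] H} {ω K : ℝ}
    (hω : ResolventBoundedRightOf (generator S) ω)
    (hK : ∀ z : ℂ, ω < z.re → ‖resolvent (generator S) z‖ ≤ K) : ResolventEstimate S ω K := by
  intro z hz w g h
  obtain ⟨hw, hAw⟩ := generator_eq_of_tendsto h
  have hR := (isResolventAt_resolvent (hω.subset_resolventSet hz)).2 ⟨w, hw⟩
  rw [hAw] at hR
  simp only [sub_sub_cancel] at hR
  calc ‖w‖ = ‖resolvent (generator S) z g‖ := by rw [hR]
    _ ≤ K * ‖g‖ := ContinuousLinearMap.le_of_opNorm_le _ (hK z hz) g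

theorem norm_resolvent_le_sSup {A : H →ₗ.[ℂ] H} {ω : ℝ} (hω : ResolventBoundedRightOf A ω)
    {z : ℂ} (hz : ω < z.re) :
    ‖resolvent A z‖ ≤ sSup ((fun z : ℂ => ‖resolvent A z‖) '' {z : ℂ | ω < z.re}) := by
  refine le_csSup ?_ ⟨z, hz, rfl⟩
  obtain ⟨C, hC⟩ := hω.bounded
  exact ⟨C, by rintro _ ⟨z, hz, rfl⟩; exact hC z hz⟩

/-- A resolvent operator cannot vanish: otherwise `y = (z - A) 0 = 0` for every `y`. -/
theorem resolventRadius_pos [Nontrivial H] {A : H →ₗ.[ℂ] H} {ω : ℝ}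
    (hω : ResolventBoundedRightOf A ω) : 0 < resolventRadius A ω := by
  have hz : ω < (((ω + 1 : ℝ) : ℂ)).re := by rw [Complex.ofReal_re]; linarith
  refine inv_pos.2 (lt_of_lt_of_le ?_ (norm_resolvent_le_sSup hω hz))
  rw [norm_pos_iff]
  intro h0
  obtain ⟨y, hy⟩ := exists_ne (0 : H)
  obtain ⟨hmem, h1⟩ := (isResolventAt_resolvent (hω.subset_resolventSet hz)).1 y
  have : (⟨resolvent A ((ω + 1 : ℝ) : ℂ) y, hmem⟩ : A.domain) = 0 := by
    ext
    simp only [h0, zero_apply, ZeroMemClass.coe_zero]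
  rw [this, LinearPMap.map_zero, h0] at h1
  simp at h1
  exact hy h1.symm

theorem IsC0Semigroup.intervalIntegrable {S : ℝ → H →L[ℂ] H} (hS : IsC0Semigroup S) (x : H)
    {a b : ℝ} (ha : 0 ≤ a) (hb : 0 ≤ b) : IntervalIntegrable (fun s => S s x) volume a b :=
  ((hS.strong_continuity x).mono fun _ hs => (le_min ha hb).trans hs.1).intervalIntegrable

/-- The integrated semigroup `x ↦ ∫_0^h S s x ds`, as a bounded operator. -/
theorem IsC0Semigroup.exists_integral {S : ℝ → H →L[ℂ] H} (hS : IsC0Semigroup S) {m : ℝ → ℝ}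
    (hm : DominatedBy S m) {h : ℝ} (hh : 0 ≤ h) :
    ∃ B : H →L[ℂ] H, ∀ x, B x = ∫ s in (0 : ℝ)..h, S s x := by
  obtain ⟨M, -, hM⟩ := hm.exists_bound h
  refine ⟨LinearMap.mkContinuous
    { toFun := fun x => ∫ s in (0 : ℝ)..h, S s x
      map_add' := fun x y => ?_
      map_smul' := fun c x => ?_ } (M * h) fun x => ?_, fun x => rfl⟩
  · simp only [_root_.map_add]
    exact intervalIntegral.integral_add (hS.intervalIntegrable x le_rfl hh)
      (hS.intervalIntegrable y le_rfl hh)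
  · rw [RingHom.id_apply, ← intervalIntegral.integral_smul]
    exact intervalIntegral.integral_congr fun s _ => (S s).map_smul c x
  · have := intervalIntegral.norm_integral_le_of_norm_le_const (a := 0) (b := h)
      (f := fun s => S s x) (C := M * ‖x‖) fun s hs => by
        rw [Set.uIoc_of_le hh] at hs
        exact ContinuousLinearMap.le_of_opNorm_le _ (hM s hs.1.le hs.2) x
    rw [sub_zero, abs_of_nonneg hh] at this
    simp only [LinearMap.coe_mk, AddHom.coe_mk]
    linarith

/-- Composition with `S τ` shifts the window `[0, h]` to `[τ, h + τ]`, and after subtraction only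
two end pieces of length `τ` remain. Being in operator norm, the bound passes to adjoints. -/
theorem IsC0Semigroup.norm_integral_comp_sub_le {S : ℝ → H →L[ℂ] H} (hS : IsC0Semigroup S)
    {h M : ℝ} (hh : 0 ≤ h) (hM : ∀ s, 0 ≤ s → s ≤ h + 1 → ‖S s‖ ≤ M) {B : H →L[ℂ] H}
    (hB : ∀ x, B x = ∫ s in (0 : ℝ)..h, S s x) {τ : ℝ} (h0 : 0 ≤ τ) (h1 : τ ≤ 1) :
    ‖B.comp (S τ) - B‖ ≤ 2 * M * τ := by
  have hM0 : 0 ≤ M := (norm_nonneg _).trans (hM 0 le_rfl (by linarith))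
  refine ContinuousLinearMap.opNorm_le_bound _ (by positivity) fun x => ?_
  have e1 : B (S τ x) = ∫ s in τ..(h + τ), S s x := by
    rw [hB]
    have : ∫ s in (0 : ℝ)..h, S s (S τ x) = ∫ s in (0 : ℝ)..h, S (s + τ) x := by
      refine intervalIntegral.integral_congr fun s hs => ?_
      rw [Set.uIcc_of_le hh] at hs
      exact (hS.apply_add hs.1 h0 x).symm
    rw [this, intervalIntegral.integral_comp_add_right (fun s => S s x), zero_add]
  have e2 : (∫ s in τ..(h + τ), S s x) - ∫ s in (0 : ℝ)..h, S s x =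
      (∫ s in h..(h + τ), S s x) - ∫ s in (0 : ℝ)..τ, S s x := by
    have hhτ : 0 ≤ h + τ := by linarith
    rw [← intervalIntegral.integral_add_adjacent_intervals
        (hS.intervalIntegrable x h0 le_rfl) (hS.intervalIntegrable x le_rfl hhτ),
      ← intervalIntegral.integral_add_adjacent_intervals
        (hS.intervalIntegrable x hh le_rfl) (hS.intervalIntegrable x le_rfl hhτ),
      intervalIntegral.integral_symm 0 τ, intervalIntegral.integral_symm 0 h]
    abel
  have b1 : ‖∫ s in h..(h + τ), S s x‖ ≤ M * ‖x‖ * τ := by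
    have := intervalIntegral.norm_integral_le_of_norm_le_const (a := h) (b := h + τ)
      (f := fun s => S s x) (C := M * ‖x‖) fun s hs => by
        rw [Set.uIoc_of_le (by linarith)] at hs
        exact ContinuousLinearMap.le_of_opNorm_le _ (hM s (by linarith [hs.1]) (by linarith [hs.2])) x
    rwa [add_sub_cancel_left, abs_of_nonneg h0] at this
  have b2 : ‖∫ s in (0 : ℝ)..τ, S s x‖ ≤ M * ‖x‖ * τ := by
    have := intervalIntegral.norm_integral_le_of_norm_le_const (a := 0) (b := τ)
      (f := fun s => S s x) (C := M * ‖x‖) fun s hs => by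
        rw [Set.uIoc_of_le h0] at hs
        exact ContinuousLinearMap.le_of_opNorm_le _ (hM s (by linarith [hs.1]) (by linarith [hs.2])) x
    rwa [sub_zero, abs_of_nonneg h0] at this
  calc ‖(B.comp (S τ) - B) x‖
      = ‖(∫ s in h..(h + τ), S s x) - ∫ s in (0 : ℝ)..τ, S s x‖ := by
        rw [← e2, ← e1, ← hB]; rfl
    _ ≤ M * ‖x‖ * τ + M * ‖x‖ * τ := (norm_sub_le _ _).trans (add_le_add b1 b2)
    _ = 2 * M * τ * ‖x‖ := by ring

end Basic

/-! ### The adjoint semigroup. -/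

section Adjoint

variable {H : Type*} [NormedAddCommGroup H] [InnerProductSpace ℂ H] [CompleteSpace H]

/-- The semigroup of adjoints. -/
noncomputable def adjointSemigroup (S : ℝ → H →L[ℂ] H) : ℝ → H →L[ℂ] H :=
  fun t => ContinuousLinearMap.adjoint (S t)

theorem norm_adjointSemigroup (S : ℝ → H →L[ℂ] H) (t : ℝ) : ‖adjointSemigroup S t‖ = ‖S t‖ :=
  LinearIsometryEquiv.norm_map _ _

theorem DominatedBy.adjointSemigroup {S : ℝ → H →L[ℂ] H} {m : ℝ → ℝ} (hm : DominatedBy S m) :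
    DominatedBy (adjointSemigroup S) m :=
  ⟨hm.1, fun t ht => (norm_adjointSemigroup S t).trans_le (hm.2 t ht)⟩

/-- The vectors at which the adjoint semigroup is right-continuous at `0`. -/
def adjointContinuitySpace (S : ℝ → H →L[ℂ] H) : Submodule ℂ H where
  carrier := {y | Tendsto (fun τ => adjointSemigroup S τ y) (𝓝[≥] 0) (𝓝 y)}
  zero_mem' := by simp
  add_mem' := fun {x y} hx hy => by
    simp only [Set.mem_ofPred_eq, map_add] at *
    exact hx.add hy
  smul_mem' := fun c x hx => by
    simp only [Set.mem_ofPred_eq, map_smul] at *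
    exact hx.const_smul c

/-- With `B = ∫_0^δ S(s) ds`, the range of `B*` consists of continuity vectors. A vector `x`
orthogonal to them has `‖Bx‖² = ⟨B*Bx, x⟩ = 0`, whereas `Bx` is within `δ‖x‖/2` of `δx` for small
`δ`. -/
theorem IsC0Semigroup.orthogonal_adjointContinuitySpace {S : ℝ → H →L[ℂ] H}
    (hS : IsC0Semigroup S) {m : ℝ → ℝ} (hm : DominatedBy S m) :
    (adjointContinuitySpace S)ᗮ = ⊥ := by
  rw [Submodule.eq_bot_iff]
  intro x hx
  by_contra hx0
  have hxpos : 0 < ‖x‖ := norm_pos_iff.2 hx0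
  have hc : Tendsto (fun s => S s x) (𝓝[≥] 0) (𝓝 x) := by
    have := hS.strong_continuity x 0 (Set.mem_Ici.2 le_rfl)
    simpa [ContinuousWithinAt, hS.map_zero] using this
  have hev : ∀ᶠ s in 𝓝[≥] (0 : ℝ), ‖S s x - x‖ < ‖x‖ / 2 := by
    have := (tendsto_iff_norm_sub_tendsto_zero.1 hc)
    exact this.eventually_lt_const (by positivity)
  obtain ⟨δ, hδ, hsub⟩ := mem_nhdsGE_iff_exists_Icc_subset.1 hev
  have hδ : 0 < δ := hδ
  obtain ⟨B, hB⟩ := hS.exists_integral hm hδ.le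
  obtain ⟨M, hM1, hM⟩ := hm.exists_bound (δ + 1)
  have hmem : ContinuousLinearMap.adjoint B (B x) ∈ adjointContinuitySpace S := by
    change Tendsto (fun τ => ContinuousLinearMap.adjoint (S τ) (ContinuousLinearMap.adjoint B (B x)))
      (𝓝[≥] 0) (𝓝 (ContinuousLinearMap.adjoint B (B x)))
    rw [tendsto_iff_norm_sub_tendsto_zero]
    have hlim : Tendsto (fun τ : ℝ => 2 * M * τ * ‖B x‖) (𝓝[≥] 0) (𝓝 0) := by
      have : Continuous fun τ : ℝ => 2 * M * τ * ‖B x‖ := by fun_prop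
      simpa using (this.tendsto 0).mono_left nhdsWithin_le_nhds
    refine squeeze_zero' (Eventually.of_forall fun _ => norm_nonneg _) ?_ hlim
    filter_upwards [Icc_mem_nhdsGE (zero_lt_one' ℝ)] with τ hτ
    have e : ContinuousLinearMap.adjoint (S τ) (ContinuousLinearMap.adjoint B (B x)) -
        ContinuousLinearMap.adjoint B (B x) =
        ContinuousLinearMap.adjoint (B.comp (S τ) - B) (B x) := by
      rw [map_sub, ContinuousLinearMap.adjoint_comp]; rfl
    rw [e]
    refine ContinuousLinearMap.le_of_opNorm_le _ ?_ _
    rw [LinearIsometryEquiv.norm_map]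
    exact hS.norm_integral_comp_sub_le hδ.le hM hB hτ.1 hτ.2
  have h0 : B x = 0 := by
    have := (Submodule.mem_orthogonal _ x).1 hx _ hmem
    rw [ContinuousLinearMap.adjoint_inner_left] at this
    exact inner_self_eq_zero.1 this
  have hd : ‖∫ s in (0 : ℝ)..δ, (S s x - x)‖ ≤ ‖x‖ / 2 * |δ - 0| := by
    refine intervalIntegral.norm_integral_le_of_norm_le_const fun s hs => ?_
    rw [Set.uIoc_of_le hδ.le] at hs
    exact (hsub ⟨hs.1.le, hs.2⟩ : ‖S s x - x‖ < ‖x‖ / 2).le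
  rw [intervalIntegral.integral_sub (hS.intervalIntegrable x le_rfl hδ.le)
    intervalIntegrable_const, ← hB, h0, intervalIntegral.integral_const, zero_sub, norm_neg,
    norm_smul, sub_zero, Real.norm_eq_abs, abs_of_pos hδ] at hd
  nlinarith

/-- The continuity vectors are dense, and local boundedness extends right-continuity at `0` to all
vectors. The semigroup law then carries it to every time. -/
theorem IsC0Semigroup.adjointSemigroup {S : ℝ → H →L[ℂ] H} (hS : IsC0Semigroup S) {m : ℝ → ℝ}
    (hm : DominatedBy S m) : IsC0Semigroup (adjointSemigroup S) := by
  have hadd : ∀ s t : ℝ, 0 ≤ s → 0 ≤ t → GearhartPruss.adjointSemigroup S (s + t) =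
      (GearhartPruss.adjointSemigroup S s).comp (GearhartPruss.adjointSemigroup S t) := by
    intro s t hs ht
    rw [add_comm, GearhartPruss.adjointSemigroup, hS.map_add t s ht hs,
      ContinuousLinearMap.adjoint_comp]
    rfl
  refine ⟨?_, hadd, fun y t₀ ht₀ => ?_⟩
  · rw [GearhartPruss.adjointSemigroup, hS.map_zero]
    exact ContinuousLinearMap.adjoint_id
  set T := GearhartPruss.adjointSemigroup S with hT
  have ht₀ : 0 ≤ t₀ := ht₀
  obtain ⟨M, hM1, hM⟩ := hm.adjointSemigroup.exists_bound (t₀ + 1)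
  rw [← hT] at hM
  have hM0 : 0 < M := by linarith
  -- right-continuity at `0`
  have hzero : ∀ ε > 0, ∀ᶠ τ in 𝓝[≥] (0 : ℝ), ‖T τ y - y‖ < ε := by
    intro ε hε
    have hcl : y ∈ (adjointContinuitySpace S).topologicalClosure := by
      rw [(Submodule.topologicalClosure_eq_top_iff).2 (hS.orthogonal_adjointContinuitySpace hm)]
      trivial
    -- The radius makes `(M + 1)‖y - y'‖ < ε / 2`, covering both error terms that involve `y - y'`.
    obtain ⟨y', hy', hd⟩ := Metric.mem_closure_iff.1 hcl (ε / (2 * (M + 1))) (by positivity)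
    rw [dist_eq_norm, lt_div_iff₀ (by positivity)] at hd
    have hy'' : Tendsto (fun τ => T τ y') (𝓝[≥] 0) (𝓝 y') := hy'
    filter_upwards [(tendsto_iff_norm_sub_tendsto_zero.1 hy'').eventually_lt_const (half_pos hε),
      Icc_mem_nhdsGE (zero_lt_one' ℝ)] with τ h1 hτ
    have h2 : ‖T τ (y - y')‖ ≤ M * ‖y - y'‖ :=
      ContinuousLinearMap.le_of_opNorm_le _ (hM τ hτ.1 (by linarith [hτ.2])) _
    have e : T τ y - y = T τ (y - y') + (T τ y' - y') - (y - y') := by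
      rw [map_sub]; abel
    have h3 : ‖T τ y - y‖ ≤ ‖T τ (y - y')‖ + ‖T τ y' - y'‖ + ‖y - y'‖ := by
      rw [e]; exact (norm_sub_le _ _).trans (add_le_add_left (norm_add_le _ _) _)
    linarith
  rw [Metric.continuousWithinAt_iff]
  intro ε hε
  obtain ⟨δ, hδ, hsub⟩ := mem_nhdsGE_iff_exists_Icc_subset.1 (hzero (ε / M) (by positivity))
  have hδ : 0 < δ := hδ
  have hsub : ∀ τ, 0 ≤ τ → τ ≤ δ → ‖T τ y - y‖ < ε / M := fun τ h0 h1 => hsub ⟨h0, h1⟩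
  -- Factoring out the smaller of the two times makes one estimate serve continuity from both sides.
  have key : ∀ a b, 0 ≤ a → a ≤ b → a ≤ t₀ + 1 → b - a ≤ δ → ‖T b y - T a y‖ < ε := by
    intro a b ha hab ha1 hba
    have : T b y - T a y = T a (T (b - a) y - y) := by
      have h := hadd a (b - a) ha (by linarith)
      rw [add_sub_cancel] at h
      rw [h, map_sub]; rfl
    rw [this]
    refine (ContinuousLinearMap.le_of_opNorm_le _ (hM a ha ha1) _).trans_lt ?_
    have := hsub (b - a) (by linarith) hba
    rwa [lt_div_iff₀ hM0, mul_comm] at this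
  refine ⟨min δ 1, by positivity, fun {t} ht hdist => ?_⟩
  have ht : 0 ≤ t := ht
  rw [Real.dist_eq, lt_min_iff] at hdist
  have habs := abs_lt.1 hdist.1
  have habs' := abs_lt.1 hdist.2
  rw [dist_eq_norm]
  rcases le_total t t₀ with h | h
  · rw [norm_sub_rev]
    exact key t t₀ ht h (by linarith) (by linarith)
  · exact key t₀ t ht₀ h (by linarith) (by linarith)

theorem tendsto_inner_diffQuot {S : ℝ → H →L[ℂ] H} {x y w v : H}
    (hx : Tendsto (diffQuot S x) (𝓝[>] 0) (𝓝 y))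
    (hw : Tendsto (diffQuot (adjointSemigroup S) w) (𝓝[>] 0) (𝓝 v)) :
    ⟪w, y⟫_ℂ = ⟪v, x⟫_ℂ := by
  refine tendsto_nhds_unique ((tendsto_const_nhds (x := w)).inner hx)
    ((hw.inner (tendsto_const_nhds (x := x))).congr fun h => ?_)
  simp only [diffQuot, adjointSemigroup, inner_smul_left, inner_smul_right, inner_sub_left,
    inner_sub_right, ContinuousLinearMap.adjoint_inner_left, Complex.conj_ofReal]

/-- Duality at the conjugate point, which has the same real part: with `R = (z̄ - A)⁻¹`, `‖w‖² = ⟨w,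
(z̄ - A)Rw⟩ = ⟨g, Rw⟩ ≤ K‖g‖‖w‖`. -/
theorem resolventEstimate_adjointSemigroup {S : ℝ → H →L[ℂ] H} {ω K : ℝ}
    (hω : ResolventBoundedRightOf (generator S) ω)
    (hK : ∀ z : ℂ, ω < z.re → ‖resolvent (generator S) z‖ ≤ K) :
    ResolventEstimate (adjointSemigroup S) ω K := by
  intro z hz w g h
  have hz' : ω < (starRingEnd ℂ z).re := by rwa [Complex.conj_re]
  set R := resolvent (generator S) (starRingEnd ℂ z)
  obtain ⟨hmem, hRw⟩ := (isResolventAt_resolvent (hω.subset_resolventSet hz')).1 w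
  have e := tendsto_inner_diffQuot (tendsto_diffQuot_generator S ⟨R w, hmem⟩) h
  have e1 : generator S ⟨R w, hmem⟩ = starRingEnd ℂ z • R w - w := by
    exact (sub_eq_of_eq_add' (sub_eq_iff_eq_add.1 hRw)).symm
  have e2 : ⟪w, w⟫_ℂ = ⟪g, R w⟫_ℂ := by
    rw [e1] at e
    simp only [inner_sub_left, inner_sub_right, inner_smul_left, inner_smul_right] at e
    exact sub_right_injective e
  have e3 : ‖w‖ ^ 2 ≤ ‖g‖ * (K * ‖w‖) := by
    have : ‖⟪w, w⟫_ℂ‖ = ‖w‖ ^ 2 := by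
      rw [inner_self_eq_norm_sq_to_K]; simp
    rw [← this, e2]
    refine (norm_inner_le_norm _ _).trans ?_
    gcongr
    exact ContinuousLinearMap.le_of_opNorm_le _ (hK _ hz') w
  rcases (norm_nonneg w).eq_or_lt with h0 | h0
  · rw [← h0]
    exact mul_nonneg ((norm_nonneg _).trans (hK z hz)) (norm_nonneg g)
  · nlinarith

end Adjoint

end GearhartPruss

namespace GearhartPruss

/-! ### Laplace transforms along orbits and the weighted `L²` estimate on the half-line. -/

section Laplace

open MeasureTheory FourierTransform

theorem integral_sq_norm_le_of_eLpNorm_le {E : Type*} [NormedAddCommGroup E] {f g : ℝ → E} (hf : MemLp f 2 volume)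
    (hg : MemLp g 2 volume) {K : ℝ} (hK : 0 ≤ K)
    (h : eLpNorm f 2 volume ≤ ENNReal.ofReal K * eLpNorm g 2 volume) :
    ∫ s, ‖f s‖ ^ 2 ≤ K ^ 2 * ∫ s, ‖g s‖ ^ 2 := by
  have e : ∀ {f : ℝ → E}, MemLp f 2 volume →
      ∫ s, ‖f s‖ ^ 2 = (eLpNorm f 2 volume).toReal ^ 2 := by
    intro f hf
    have h0 : 0 ≤ ∫ s, ‖f s‖ ^ 2 := integral_nonneg fun s => by positivity
    rw [hf.eLpNorm_eq_integral_rpow_norm two_ne_zero ENNReal.ofNat_ne_top,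
      ENNReal.toReal_ofReal (by positivity)]
    simp only [ENNReal.toReal_ofNat, Real.rpow_ofNat]
    rw [← Real.rpow_natCast, ← Real.rpow_mul h0]
    norm_num
  rw [e hf, e hg, ← mul_pow]
  have := ENNReal.toReal_mono (ENNReal.mul_ne_top ENNReal.ofReal_ne_top hg.2.ne) h
  rw [ENNReal.toReal_mul, ENNReal.toReal_ofReal hK] at this
  exact pow_le_pow_left₀ ENNReal.toReal_nonneg this 2

variable {H : Type*} [NormedAddCommGroup H] [InnerProductSpace ℂ H]

/-- The orbit of `x`, frozen for negative times. -/
def orbit (S : ℝ → H →L[ℂ] H) (x : H) (s : ℝ) : H := S (max s 0) x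

theorem orbit_of_nonneg (S : ℝ → H →L[ℂ] H) (x : H) {s : ℝ} (hs : 0 ≤ s) :
    orbit S x s = S s x := by rw [orbit, max_eq_left hs]

theorem IsC0Semigroup.continuous_orbit {S : ℝ → H →L[ℂ] H} (hS : IsC0Semigroup S) (x : H) :
    Continuous (orbit S x) :=
  (hS.strong_continuity x).comp_continuous (by fun_prop) fun s => le_max_right s 0

/-- `‖S s‖ ≤ C e^{β s}` for `s ≥ 0`. -/
def GrowthBound (S : ℝ → H →L[ℂ] H) (C β : ℝ) : Prop :=
  ∀ s, 0 ≤ s → ‖S s‖ ≤ C * Real.exp (β * s)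

theorem GrowthBound.norm_orbit_le {S : ℝ → H →L[ℂ] H} {C β : ℝ} (hg : GrowthBound S C β) (x : H)
    {s : ℝ} (hs : 0 ≤ s) : ‖orbit S x s‖ ≤ C * Real.exp (β * s) * ‖x‖ := by
  rw [orbit_of_nonneg S x hs]
  exact ContinuousLinearMap.le_of_opNorm_le _ (hg s hs) x

theorem GrowthBound.nonneg {S : ℝ → H →L[ℂ] H} {C β : ℝ} (hg : GrowthBound S C β) : 0 ≤ C := by
  have := (norm_nonneg _).trans (hg 0 le_rfl)
  simpa using this

/-- The integrand `e^{-z s} ψ(s) u(s)` of a Laplace transform along the orbit `u` of `x`. -/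
noncomputable def laplaceIntegrand (S : ℝ → H →L[ℂ] H) (x : H) (ψ : ℝ → ℝ) (z : ℂ) (s : ℝ) : H :=
  (Complex.exp (-z * s) * (ψ s : ℂ)) • orbit S x s

theorem norm_laplaceIntegrand (S : ℝ → H →L[ℂ] H) (x : H) (ψ : ℝ → ℝ) (z : ℂ) (s : ℝ) :
    ‖laplaceIntegrand S x ψ z s‖ = Real.exp (-z.re * s) * |ψ s| * ‖orbit S x s‖ := by
  rw [laplaceIntegrand, norm_smul, norm_mul, Complex.norm_exp, Complex.norm_real,
    Real.norm_eq_abs]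
  simp

variable {S : ℝ → H →L[ℂ] H} {C β : ℝ} {ψ : ℝ → ℝ} {N : ℝ}

theorem norm_laplaceIntegrand_le (hg : GrowthBound S C β) (hψN : ∀ s, |ψ s| ≤ N)
    (hψ0 : ∀ s ≤ 0, ψ s = 0) (x : H) (z : ℂ) (s : ℝ) :
    ‖laplaceIntegrand S x ψ z s‖ ≤
      (Set.Ioi 0).indicator (fun s => N * C * ‖x‖ * Real.exp (-(z.re - β) * s)) s := by
  rw [norm_laplaceIntegrand]
  rcases le_or_gt s 0 with hs | hs
  · rw [hψ0 s hs, Set.indicator_of_notMem (by simpa using hs)]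
    simp
  · rw [Set.indicator_of_mem (Set.mem_Ioi.2 hs)]
    have e : Real.exp (-(z.re - β) * s) = Real.exp (-z.re * s) * Real.exp (β * s) := by
      rw [← Real.exp_add]; ring_nf
    have hN : 0 ≤ N := (abs_nonneg _).trans (hψN 0)
    calc Real.exp (-z.re * s) * |ψ s| * ‖orbit S x s‖
        ≤ Real.exp (-z.re * s) * N * (C * Real.exp (β * s) * ‖x‖) := by
          gcongr
          · exact hψN s
          · exact hg.norm_orbit_le x hs.le
      _ = N * C * ‖x‖ * Real.exp (-(z.re - β) * s) := by rw [e]; ring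

theorem aestronglyMeasurable_laplaceIntegrand (hS : IsC0Semigroup S) (hψ : Measurable ψ) (x : H)
    (z : ℂ) : AEStronglyMeasurable (laplaceIntegrand S x ψ z) volume := by
  have h : Measurable fun s : ℝ => Complex.exp (-z * s) * (ψ s : ℂ) := by fun_prop
  exact h.aestronglyMeasurable.smul (hS.continuous_orbit x).aestronglyMeasurable

theorem integrable_indicator_exp (c : ℝ) {a : ℝ} (ha : 0 < a) :
    Integrable ((Set.Ioi (0 : ℝ)).indicator fun s => c * Real.exp (-a * s)) volume :=
  (integrable_indicator_iff measurableSet_Ioi).2 ((exp_neg_integrableOn_Ioi 0 ha).const_mul c)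

theorem integrable_laplaceIntegrand (hS : IsC0Semigroup S) (hg : GrowthBound S C β)
    (hψ : Measurable ψ) (hψN : ∀ s, |ψ s| ≤ N) (hψ0 : ∀ s ≤ 0, ψ s = 0) (x : H) {z : ℂ}
    (hz : β < z.re) : Integrable (laplaceIntegrand S x ψ z) volume :=
  (integrable_indicator_exp _ (sub_pos.2 hz)).mono'
    (aestronglyMeasurable_laplaceIntegrand hS hψ x z)
    (Eventually.of_forall (norm_laplaceIntegrand_le hg hψN hψ0 x z))

theorem memLp_two_laplaceIntegrand (hS : IsC0Semigroup S) (hg : GrowthBound S C β)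
    (hψ : Measurable ψ) (hψN : ∀ s, |ψ s| ≤ N) (hψ0 : ∀ s ≤ 0, ψ s = 0) (x : H) {z : ℂ}
    (hz : β < z.re) : MemLp (laplaceIntegrand S x ψ z) 2 volume := by
  have hm := aestronglyMeasurable_laplaceIntegrand hS hψ x z
  rw [memLp_two_iff_integrable_sq_norm hm]
  refine (integrable_indicator_exp ((N * C * ‖x‖) ^ 2)
    (mul_pos two_pos (sub_pos.2 hz))).mono' (hm.norm.pow 2) (Eventually.of_forall fun s => ?_)
  rw [Real.norm_of_nonneg (by positivity)]
  refine (pow_le_pow_left₀ (norm_nonneg _) (norm_laplaceIntegrand_le hg hψN hψ0 x z s) 2).trans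
    (le_of_eq ?_)
  by_cases hs : s ∈ Set.Ioi (0 : ℝ)
  · rw [Set.indicator_of_mem hs, Set.indicator_of_mem hs, mul_pow, ← Real.exp_nat_mul]
    ring_nf
  · rw [Set.indicator_of_notMem hs, Set.indicator_of_notMem hs]
    ring

variable {φ : ℝ → ℝ} {L : NNReal}

theorem deriv_eq_zero_of_nonpos (hφ0 : ∀ s ≤ 0, φ s = 0) {s : ℝ} (hs : s ≤ 0) :
    deriv φ s = 0 := by
  by_cases hd : DifferentiableAt ℝ φ s
  · have h1 : HasDerivWithinAt φ (deriv φ s) (Set.Iic s) s := hd.hasDerivAt.hasDerivWithinAt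
    have h2 : HasDerivWithinAt φ 0 (Set.Iic s) s :=
      (hasDerivWithinAt_const s (Set.Iic s) (0 : ℝ)).congr
        (fun y hy => hφ0 y (le_trans hy hs)) (hφ0 s hs)
    exact (uniqueDiffWithinAt_Iic s).eq_deriv _ h1 h2
  -- There may be a corner at `s = 0`; there `deriv` takes its default value `0`.
  · exact deriv_zero_of_not_differentiableAt hd

theorem abs_deriv_le_of_lipschitz (hφL : LipschitzWith L φ) (s : ℝ) : |deriv φ s| ≤ L := by
  simpa using norm_deriv_le_of_lipschitz (x₀ := s) hφL

/-- Since `S(h)S(s - h)x = S(s)x`, a translation moves the action of `S h` onto the scalar weight.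
Differentiation in `h` then falls on scalars, and `x` need not lie in the domain of `A`. -/
theorem apply_integral_laplaceIntegrand [CompleteSpace H] (hS : IsC0Semigroup S)
    (hg : GrowthBound S C β) (hφL : LipschitzWith L φ) (hφN : ∀ s, |φ s| ≤ N)
    (hφ0 : ∀ s ≤ 0, φ s = 0) (x : H) {z : ℂ} (hz : β < z.re) {h : ℝ} (hh : 0 ≤ h) :
    S h (∫ s, laplaceIntegrand S x φ z s) =
      ∫ s : ℝ, (Complex.exp (-z * (s - h : ℝ)) * (φ (s - h) : ℂ)) • orbit S x s := by
  rw [← ContinuousLinearMap.integral_comp_comm _ (integrable_laplaceIntegrand hS hg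
    hφL.continuous.measurable hφN hφ0 x hz), ← integral_sub_right_eq_self _ h]
  refine integral_congr_ae (Eventually.of_forall fun s => ?_)
  simp only [laplaceIntegrand, map_smul]
  rcases le_total (s - h) 0 with hs | hs
  · simp [hφ0 _ hs]
  · congr 1
    rw [orbit_of_nonneg S x hs, orbit_of_nonneg S x (by linarith), ← hS.apply_add hh hs,
      add_sub_cancel]

theorem norm_exp_mul_sub_one_le (z : ℂ) {h : ℝ} (h0 : 0 ≤ h) (h1 : h ≤ 1) :
    ‖Complex.exp (z * h) - 1‖ ≤ ‖z‖ * Real.exp ‖z‖ * h := by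
  have hn : ‖z * (h : ℂ)‖ = ‖z‖ * h := by rw [norm_mul, Complex.norm_real, Real.norm_of_nonneg h0]
  have := Complex.norm_exp_sub_sum_le_norm_mul_exp (z * h) 1
  simp only [Finset.range_one, Finset.sum_singleton, pow_zero, Nat.factorial_zero, Nat.cast_one,
    div_one, pow_one, hn] at this
  refine this.trans ?_
  have : Real.exp (‖z‖ * h) ≤ Real.exp ‖z‖ :=
    Real.exp_le_exp.2 (mul_le_of_le_one_right (norm_nonneg z) h1)
  calc ‖z‖ * h * Real.exp (‖z‖ * h) ≤ ‖z‖ * h * Real.exp ‖z‖ := by gcongr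
    _ = _ := by ring

/-- Bounds the difference quotients of `e^{-zs}φ(s)` uniformly in `h ≤ 1` while keeping the factor
`e^{-Re z s}`, as dominated convergence requires. -/
theorem norm_exp_mul_shift_sub_le (hφL : LipschitzWith L φ) (hφN : ∀ s, |φ s| ≤ N) (z : ℂ)
    {h : ℝ} (h0 : 0 ≤ h) (h1 : h ≤ 1) (s : ℝ) :
    ‖Complex.exp (-z * (s - h : ℝ)) * (φ (s - h) : ℂ) - Complex.exp (-z * s) * (φ s : ℂ)‖ ≤
      Real.exp (-z.re * s) * ((‖z‖ * Real.exp ‖z‖ * N + L) * h) := by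
  have e : Complex.exp (-z * (s - h : ℝ)) * (φ (s - h) : ℂ) - Complex.exp (-z * s) * (φ s : ℂ) =
      Complex.exp (-z * s) * ((Complex.exp (z * h) - 1) * (φ (s - h) : ℂ) +
        ((φ (s - h) - φ s : ℝ) : ℂ)) := by
    have : Complex.exp (-z * (s - h : ℝ)) = Complex.exp (-z * s) * Complex.exp (z * h) := by
      rw [← Complex.exp_add]; push_cast; ring_nf
    rw [this]; push_cast; ring
  have hd : |φ (s - h) - φ s| ≤ L * h := by
    have := hφL.dist_le_mul (s - h) s
    rwa [Real.dist_eq, Real.dist_eq, sub_sub_cancel_left, abs_neg, abs_of_nonneg h0] at this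
  rw [e, norm_mul, Complex.norm_exp]
  have e2 : (-z * (s : ℂ)).re = -z.re * s := by simp
  rw [e2]
  refine mul_le_mul_of_nonneg_left ?_ (Real.exp_nonneg _)
  refine (norm_add_le _ _).trans ?_
  rw [norm_mul, Complex.norm_real, Complex.norm_real, Real.norm_eq_abs, Real.norm_eq_abs, add_mul]
  refine add_le_add ?_ hd
  calc ‖Complex.exp (z * h) - 1‖ * |φ (s - h)| ≤ (‖z‖ * Real.exp ‖z‖ * h) * N := by
        gcongr
        · exact norm_exp_mul_sub_one_le z h0 h1
        · exact hφN _
    _ = _ := by ring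

/-- The Laplace transform `V` of `φ u` satisfies `(z - A) V = ∫ e^{-z s} φ'(s) u(s) ds`. -/
theorem tendsto_diffQuot_integral_laplaceIntegrand [CompleteSpace H] (hS : IsC0Semigroup S)
    (hg : GrowthBound S C β) (hφL : LipschitzWith L φ) (hφN : ∀ s, |φ s| ≤ N)
    (hφ0 : ∀ s ≤ 0, φ s = 0) (x : H) {z : ℂ} (hz : β < z.re) :
    Tendsto (diffQuot S (∫ s, laplaceIntegrand S x φ z s)) (𝓝[>] 0)
      (𝓝 (z • (∫ s, laplaceIntegrand S x φ z s) - ∫ s, laplaceIntegrand S x (deriv φ) z s)) := by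
  have hφm := hφL.continuous.measurable
  have hF := integrable_laplaceIntegrand hS hg hφm hφN hφ0 x hz
  have hG := integrable_laplaceIntegrand hS hg (measurable_deriv φ)
    (abs_deriv_le_of_lipschitz hφL) (fun s hs => deriv_eq_zero_of_nonpos hφ0 hs) x hz
  set ρ : ℝ → ℂ := fun s => Complex.exp (-z * s) * (φ s : ℂ) with hρ
  have hρc : Continuous ρ := by
    have := hφL.continuous
    fun_prop
  have hN : 0 ≤ N := (abs_nonneg _).trans (hφN 0)
  have hbound : ∀ h : ℝ, 0 < h → h ≤ 1 → ∀ s : ℝ, ‖((h⁻¹ : ℝ) : ℂ) • (ρ (s - h) - ρ s) • orbit S x s‖ ≤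
      (Set.Ioi 0).indicator (fun s => ((‖z‖ * Real.exp ‖z‖ * N + L) * C * ‖x‖) *
        Real.exp (-(z.re - β) * s)) s := by
    intro h h0 h1 s
    rcases le_or_gt s 0 with hs | hs
    · rw [Set.indicator_of_notMem (by simpa using hs)]
      simp [hρ, hφ0 s hs, hφ0 (s - h) (by linarith)]
    · rw [Set.indicator_of_mem (Set.mem_Ioi.2 hs), norm_smul, norm_smul, Complex.norm_real,
        norm_inv, Real.norm_of_nonneg h0.le]
      have e : Real.exp (-(z.re - β) * s) = Real.exp (-z.re * s) * Real.exp (β * s) := by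
        rw [← Real.exp_add]; ring_nf
      calc h⁻¹ * (‖ρ (s - h) - ρ s‖ * ‖orbit S x s‖)
          ≤ h⁻¹ * ((Real.exp (-z.re * s) * ((‖z‖ * Real.exp ‖z‖ * N + L) * h)) *
              (C * Real.exp (β * s) * ‖x‖)) := by
            gcongr
            · exact norm_exp_mul_shift_sub_le hφL hφN z h0.le h1 s
            · exact hg.norm_orbit_le x hs.le
        _ = ((‖z‖ * Real.exp ‖z‖ * N + L) * C * ‖x‖) * Real.exp (-(z.re - β) * s) := by
            rw [e]; field_simp
  -- A Lipschitz `φ` is differentiable almost everywhere, and the quotient tends to `-ρ'(s) u(s)`.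
  have hlim : ∀ᵐ s : ℝ, Tendsto (fun h : ℝ => ((h⁻¹ : ℝ) : ℂ) • (ρ (s - h) - ρ s) • orbit S x s)
      (𝓝[>] 0) (𝓝 (z • laplaceIntegrand S x φ z s - laplaceIntegrand S x (deriv φ) z s)) := by
    filter_upwards [hφL.ae_differentiableAt_of_real] with s hs
    have hd : HasDerivAt ρ (Complex.exp (-z * s) * (-z) * (φ s : ℂ) +
        Complex.exp (-z * s) * ((deriv φ s : ℝ) : ℂ)) s := by
      have h1 : HasDerivAt (fun s : ℝ => Complex.exp (-z * s)) (Complex.exp (-z * s) * (-z)) s := by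
        have := ((Complex.ofRealCLM.hasDerivAt (x := s)).const_mul (-z)).cexp
        simpa using this
      exact h1.mul hs.hasDerivAt.ofReal_comp
    have hd' : HasDerivAt ρ (Complex.exp (-z * s) * (-z) * (φ s : ℂ) +
        Complex.exp (-z * s) * ((deriv φ s : ℝ) : ℂ)) (s - 0) := by rwa [sub_zero]
    have ht := (hd'.comp_const_sub s 0).tendsto_slope_zero_right
    have := ht.smul_const (orbit S x s)
    have e : z • laplaceIntegrand S x φ z s - laplaceIntegrand S x (deriv φ) z s =
        (-(Complex.exp (-z * s) * (-z) * (φ s : ℂ) +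
        Complex.exp (-z * s) * ((deriv φ s : ℝ) : ℂ))) • orbit S x s := by
      rw [laplaceIntegrand, laplaceIntegrand, smul_smul, ← sub_smul]
      congr 1; ring
    rw [e]
    refine this.congr fun h => ?_
    rw [zero_add, sub_zero, smul_assoc, Complex.coe_smul]
  have hDCT := tendsto_integral_filter_of_dominated_convergence
    (F := fun (h : ℝ) (s : ℝ) => ((h⁻¹ : ℝ) : ℂ) • (ρ (s - h) - ρ s) • orbit S x s) _
    (Eventually.of_forall fun h => by
      have := hS.continuous_orbit x
      exact Continuous.aestronglyMeasurable (by fun_prop))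
    (by
      filter_upwards [Ioc_mem_nhdsGT (zero_lt_one' ℝ)] with h hh
      exact Eventually.of_forall (hbound h hh.1 hh.2))
    (integrable_indicator_exp _ (sub_pos.2 hz)) hlim
  rw [integral_sub (f := fun s => z • laplaceIntegrand S x φ z s) (hF.smul z) hG, integral_smul] at hDCT
  refine hDCT.congr' ?_
  filter_upwards [Ioc_mem_nhdsGT (zero_lt_one' ℝ)] with h hh
  rw [diffQuot, apply_integral_laplaceIntegrand hS hg hφL hφN hφ0 x hz hh.1.le, integral_smul]
  congr 1
  rw [← integral_sub _ hF]
  · refine integral_congr_ae (Eventually.of_forall fun s => ?_)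
    simp only [laplaceIntegrand, hρ, sub_smul]
  · have hsum : Integrable (fun s : ℝ => (ρ (s - h) - ρ s) • orbit S x s) volume := by
      have : Integrable (fun s : ℝ => ((h⁻¹ : ℝ) : ℂ) • (ρ (s - h) - ρ s) • orbit S x s) volume := by
        refine (integrable_indicator_exp _ (sub_pos.2 hz)).mono' ?_
          (Eventually.of_forall (hbound h hh.1 hh.2))
        have := hS.continuous_orbit x
        exact Continuous.aestronglyMeasurable (by fun_prop)
      rw [integrable_fun_smul_iff (by simpa using hh.1.ne')] at this
      exact this
    refine (hsum.add hF).congr (Eventually.of_forall fun s => ?_)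
    simp only [laplaceIntegrand, hρ, Pi.add_apply, sub_smul, sub_add_cancel]

theorem fourier_laplaceIntegrand (x : H) (α ξ : ℝ) :
    𝓕 (laplaceIntegrand S x ψ (α : ℂ)) ξ =
      ∫ s, laplaceIntegrand S x ψ (α + (2 * Real.pi * ξ : ℝ) * Complex.I) s := by
  rw [Real.fourier_real_eq_integral_exp_smul]
  refine integral_congr_ae (Eventually.of_forall fun s => ?_)
  simp only [laplaceIntegrand]
  rw [smul_smul, ← mul_assoc, ← Complex.exp_add]
  congr 3
  push_cast
  ring

/-- The weighted `L²` estimate for the solution `φ u` of `(∂ₛ - A) v = φ' u`. -/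
theorem integral_sq_norm_laplaceIntegrand_le [CompleteSpace H] (hS : IsC0Semigroup S)
    {ω K : ℝ} (hK : 0 ≤ K) (hR : ResolventEstimate S ω K)
    (hg : GrowthBound S C β) (hφL : LipschitzWith L φ) (hφN : ∀ s, |φ s| ≤ N)
    (hφ0 : ∀ s ≤ 0, φ s = 0) (x : H) {α : ℝ} (hα : β < α) (hα' : ω < α) :
    ∫ s, ‖laplaceIntegrand S x φ (α : ℂ) s‖ ^ 2 ≤
      K ^ 2 * ∫ s, ‖laplaceIntegrand S x (deriv φ) (α : ℂ) s‖ ^ 2 := by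
  have hφm := hφL.continuous.measurable
  have hz : β < (α : ℂ).re := hα
  have hF1 := integrable_laplaceIntegrand hS hg hφm hφN hφ0 x hz
  have hF2 := memLp_two_laplaceIntegrand hS hg hφm hφN hφ0 x hz
  have hG1 := integrable_laplaceIntegrand hS hg (measurable_deriv φ)
    (abs_deriv_le_of_lipschitz hφL) (fun s hs => deriv_eq_zero_of_nonpos hφ0 hs) x hz
  have hG2 := memLp_two_laplaceIntegrand hS hg (measurable_deriv φ)
    (abs_deriv_le_of_lipschitz hφL) (fun s hs => deriv_eq_zero_of_nonpos hφ0 hs) x hz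
  refine integral_sq_norm_le_of_eLpNorm_le hF2 hG2 hK ?_
  rw [← eLpNorm_fourier_eq hF1 hF2, ← eLpNorm_fourier_eq hG1 hG2]
  -- On the Fourier side the estimate is pointwise: frequency `ξ` corresponds to `z = α + 2πiξ`,
  -- where the resolvent bound applies.
  refine eLpNorm_le_mul_eLpNorm_of_ae_le_mul (Eventually.of_forall fun ξ => ?_) 2
  rw [fourier_laplaceIntegrand, fourier_laplaceIntegrand]
  have hre : ((α : ℂ) + (2 * Real.pi * ξ : ℝ) * Complex.I).re = α := by simp
  refine hR _ (by rwa [hre]) _ _ ?_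
  exact tendsto_diffQuot_integral_laplaceIntegrand hS hg hφL hφN hφ0 x (by rwa [hre])

end Laplace

end GearhartPruss

namespace GearhartPruss

/-! ### Restriction of the weighted estimate to a finite time interval. -/

section Truncation

open MeasureTheory

variable {H : Type*} [NormedAddCommGroup H] [InnerProductSpace ℂ H]

theorem IsC0Semigroup.continuousOn_norm {S : ℝ → H →L[ℂ] H} (hS : IsC0Semigroup S) (x : H) :
    ContinuousOn (fun s => ‖S s x‖) (Set.Ici 0) := (hS.strong_continuity x).norm

theorem continuousOn_derivWithin_Ici {Φ : ℝ → ℝ} (hΦ : ContDiffOn ℝ 1 Φ (Set.Ici 0)) :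
    ContinuousOn (derivWithin Φ (Set.Ici 0)) (Set.Ici 0) :=
  hΦ.continuousOn_derivWithin (uniqueDiffOn_Ici 0) le_rfl

/-- Causal form of the weighted `L²` estimate: only the interval `[0, T]` matters. -/
theorem integral_weighted_sq_le [CompleteSpace H] {S : ℝ → H →L[ℂ] H} (hS : IsC0Semigroup S)
    {C β ω K : ℝ} (hK : 0 ≤ K) (hR : ResolventEstimate S ω K) (hg : GrowthBound S C β)
    {Φ : ℝ → ℝ} (hΦ : ContDiffOn ℝ 1 Φ (Set.Ici 0)) (hΦ0 : Φ 0 = 0) (x : H) {α : ℝ}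
    (hα : β < α) (hα' : ω < α) {T : ℝ} (hT : 0 ≤ T) :
    ∫ s in (0 : ℝ)..T, (Real.exp (-α * s) * |Φ s| * ‖S s x‖) ^ 2 ≤
      K ^ 2 * ∫ s in (0 : ℝ)..T,
        (Real.exp (-α * s) * |derivWithin Φ (Set.Ici 0) s| * ‖S s x‖) ^ 2 := by
  obtain ⟨L, hL⟩ := (hΦ.mono Set.Icc_subset_Ici_self).exists_lipschitzOnWith one_ne_zero
    (convex_Icc 0 T) isCompact_Icc
  -- `φ` is `Φ` frozen after time `T`, so `φ'` vanishes there and the right side sees only `[0, T]`;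
  -- on the left the times beyond `T` are discarded by positivity.
  set φ : ℝ → ℝ := fun s => Φ (Set.projIcc 0 T hT s) with hφ
  have hφL : LipschitzWith L φ := by
    have := hL.to_restrict.comp (LipschitzWith.projIcc hT)
    rwa [mul_one] at this
  have hφ_eq : ∀ s, 0 ≤ s → s ≤ T → φ s = Φ s := fun s h0 h1 => by
    simp only [hφ, Set.projIcc_of_mem hT ⟨h0, h1⟩]
  have hφ0 : ∀ s ≤ 0, φ s = 0 := fun s hs => by
    simp only [hφ, Set.projIcc_of_le_left hT hs, hΦ0]
  obtain ⟨N, hN⟩ := (isCompact_Icc (a := (0 : ℝ)) (b := T)).exists_bound_of_continuousOn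
    (hΦ.continuousOn.mono Set.Icc_subset_Ici_self)
  have hφN : ∀ s, |φ s| ≤ N := fun s => hN _ (Set.projIcc 0 T hT s).2
  have hderiv : ∀ s, 0 < s → s < T → deriv φ s = derivWithin Φ (Set.Ici 0) s := by
    intro s h0 h1
    have e : φ =ᶠ[𝓝 s] Φ := by
      filter_upwards [Ioo_mem_nhds h0 h1] with y hy
      exact hφ_eq y hy.1.le hy.2.le
    rw [e.deriv_eq, derivWithin_of_mem_nhds (Ici_mem_nhds h0)]
  have hderiv' : ∀ s, T < s → deriv φ s = 0 := by
    intro s hs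
    have e : φ =ᶠ[𝓝 s] fun _ => Φ T := by
      filter_upwards [Ioi_mem_nhds hs] with y hy
      simp only [hφ, Set.projIcc_of_right_le hT (le_of_lt hy)]
    rw [e.deriv_eq, deriv_const]
  have hz : β < (α : ℂ).re := hα
  have main := integral_sq_norm_laplaceIntegrand_le hS hK hR hg hφL hφN hφ0 x hα hα'
  have hint := (memLp_two_laplaceIntegrand hS hg hφL.continuous.measurable hφN hφ0 x
    hz).integrable_norm_pow two_ne_zero
  have e1 : ∫ s in (0 : ℝ)..T, (Real.exp (-α * s) * |Φ s| * ‖S s x‖) ^ 2 =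
      ∫ s in Set.Ioc 0 T, ‖laplaceIntegrand S x φ (α : ℂ) s‖ ^ 2 := by
    rw [intervalIntegral.integral_of_le hT]
    refine setIntegral_congr_fun measurableSet_Ioc fun s hs => ?_
    simp only [norm_laplaceIntegrand, Complex.ofReal_re, hφ_eq s hs.1.le hs.2,
      orbit_of_nonneg S x hs.1.le]
  have e2 : ∫ s in (0 : ℝ)..T,
      (Real.exp (-α * s) * |derivWithin Φ (Set.Ici 0) s| * ‖S s x‖) ^ 2 =
      ∫ s, ‖laplaceIntegrand S x (deriv φ) (α : ℂ) s‖ ^ 2 := by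
    rw [intervalIntegral.integral_of_le hT, integral_Ioc_eq_integral_Ioo,
      ← setIntegral_eq_integral_of_ae_compl_eq_zero (μ := volume) (s := Set.Ioo 0 T)
        (f := fun s => ‖laplaceIntegrand S x (deriv φ) (α : ℂ) s‖ ^ 2)]
    · refine setIntegral_congr_fun measurableSet_Ioo fun s hs => ?_
      simp only [norm_laplaceIntegrand, Complex.ofReal_re, hderiv s hs.1 hs.2,
        orbit_of_nonneg S x hs.1.le]
    · filter_upwards [Measure.ae_ne volume T] with s hsT hs
      have h0 : deriv φ s = 0 := by
        rcases le_or_gt s 0 with h | h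
        · exact deriv_eq_zero_of_nonpos hφ0 h
        · refine hderiv' s (lt_of_le_of_ne (not_lt.1 fun h' => hs ⟨h, h'⟩) hsT.symm)
      rw [norm_laplaceIntegrand, h0]
      simp
  rw [e1, e2]
  exact (setIntegral_le_integral hint (Eventually.of_forall fun s => by positivity)).trans main

end Truncation

/-! ### Gearhart–Prüss: growth bound with exponent `ω`, and the weighted estimate at `ω`. -/

section Growth

variable {H : Type*} [NormedAddCommGroup H] [InnerProductSpace ℂ H]

theorem GrowthBound.mono {S : ℝ → H →L[ℂ] H} {C β β' : ℝ} (hg : GrowthBound S C β)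
    (h : β ≤ β') : GrowthBound S C β' := fun s hs =>
  (hg s hs).trans (mul_le_mul_of_nonneg_left (Real.exp_le_exp.2 (by gcongr)) hg.nonneg)

theorem IsC0Semigroup.exists_growthBound {S : ℝ → H →L[ℂ] H} (hS : IsC0Semigroup S) {m : ℝ → ℝ}
    (hm : DominatedBy S m) : ∃ C a, GrowthBound S C a := by
  obtain ⟨M, hM1, hM⟩ := hm.exists_bound 1
  have hM0 : 0 < M := by linarith
  have hpow : ∀ n : ℕ, ∀ s : ℝ, 0 ≤ s → s ≤ n + 1 → ‖S s‖ ≤ M ^ (n + 1) := by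
    intro n
    induction n with
    | zero => intro s h0 h1; simpa using hM s h0 (by simpa using h1)
    | succ n ih =>
      intro s h0 h1
      rcases le_total s 1 with h | h
      · exact (hM s h0 h).trans (le_self_pow₀ hM1 (by omega))
      · have e : s = 1 + (s - 1) := by ring
        rw [e, hS.map_add 1 (s - 1) zero_le_one (by linarith), pow_succ']
        push_cast at h1
        exact (ContinuousLinearMap.opNorm_comp_le _ _).trans (mul_le_mul (hM 1 zero_le_one le_rfl)
          (ih (s - 1) (by linarith) (by linarith)) (norm_nonneg _) hM0.le)
  refine ⟨M, Real.log M, fun s hs => ?_⟩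
  refine (hpow ⌊s⌋₊ s hs (Nat.lt_floor_add_one s).le).trans ?_
  rw [pow_succ', ← Real.rpow_natCast, Real.rpow_def_of_pos hM0]
  have := Real.log_nonneg hM1
  have := Nat.floor_le hs
  gcongr

theorem integral_exp_neg_mul_le {c : ℝ} (hc : 0 < c) (T : ℝ) :
    ∫ s in (0 : ℝ)..T, Real.exp (-c * s) ≤ 1 / c := by
  have h : ∫ s in (0 : ℝ)..T, Real.exp (-c * s) = (1 - Real.exp (-c * T)) / c := by
    rw [intervalIntegral.integral_comp_mul_left (fun s => Real.exp s) (neg_ne_zero.2 hc.ne'),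
      integral_exp, mul_zero, Real.exp_zero, smul_eq_mul]
    field_simp
    ring
  rw [h]
  gcongr
  linarith [Real.exp_pos (-c * T)]

variable [CompleteSpace H]

/-- A resolvent bound `K` lets one shift the growth exponent to the left by `1 / (2 K)`
in the `L²` sense. -/
theorem integral_weighted_sq_le_of_growthBound {S : ℝ → H →L[ℂ] H} (hS : IsC0Semigroup S)
    {C β ω γ : ℝ} (hγ : 0 < γ) (hR : ResolventEstimate S ω (1 / (2 * γ))) (hg : GrowthBound S C β)
    (hω : ω < β + γ / 2) (x : H) {T : ℝ} (hT : 0 ≤ T) :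
    ∫ s in (0 : ℝ)..T, (Real.exp (-(β - γ / 2) * s) * ‖S s x‖) ^ 2 ≤
      16 * C ^ 2 / (3 * γ) * ‖x‖ ^ 2 := by
  have hC := hg.nonneg
  -- The weight is `Φ(s) = sinh(γs)`. As `Kγ = 1/2`, the estimate reads `∫ sinh² ≤ ¼ ∫ cosh²`
  -- against `e^{-2αs}‖u‖²`, and `cosh² = 1 + sinh²` leaves `¾ ∫ cosh² ≤ ∫ 1`. The last integral is
  -- finite uniformly in `T` because `α > β`, while `e^{-αs} cosh(γs)` is at least half of `e^{-(β -
  -- γ/2)s}`.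
  set α := β + γ / 2 with hα
  have hsinh : ContDiff ℝ 1 fun s => Real.sinh (γ * s) := by fun_prop
  have hd : ∀ s, 0 ≤ s → derivWithin (fun s => Real.sinh (γ * s)) (Set.Ici 0) s =
      γ * Real.cosh (γ * s) := by
    intro s hs
    have h1 : HasDerivAt (fun s => Real.sinh (γ * s)) (γ * Real.cosh (γ * s)) s := by
      have := ((hasDerivAt_id s).const_mul γ).sinh
      simpa [mul_comm] using this
    exact h1.hasDerivWithinAt.derivWithin (uniqueDiffOn_Ici 0 s hs)
  have main := integral_weighted_sq_le hS (K := 1 / (2 * γ)) (by positivity) hR hg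
    hsinh.contDiffOn (by simp) x (α := α) (by linarith) hω hT
  have hcS : ContinuousOn (fun s => ‖S s x‖) (Set.uIcc 0 T) :=
    (hS.continuousOn_norm x).mono fun s hs => by
      rw [Set.uIcc_of_le hT] at hs; exact hs.1
  have i1 : IntervalIntegrable (fun s => (Real.exp (-α * s) * |Real.sinh (γ * s)| * ‖S s x‖) ^ 2)
      MeasureTheory.volume 0 T := ContinuousOn.intervalIntegrable (by fun_prop)
  have i2 : IntervalIntegrable (fun s => (Real.exp (-α * s) * Real.cosh (γ * s) * ‖S s x‖) ^ 2)
      MeasureTheory.volume 0 T := ContinuousOn.intervalIntegrable (by fun_prop)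
  have i3 : IntervalIntegrable (fun s => (Real.exp (-α * s) * ‖S s x‖) ^ 2)
      MeasureTheory.volume 0 T := ContinuousOn.intervalIntegrable (by fun_prop)
  have i4 : IntervalIntegrable (fun s => (Real.exp (-(β - γ / 2) * s) * ‖S s x‖) ^ 2)
      MeasureTheory.volume 0 T := ContinuousOn.intervalIntegrable (by fun_prop)
  have e1 : ∫ s in (0 : ℝ)..T, (Real.exp (-α * s) *
        |derivWithin (fun s => Real.sinh (γ * s)) (Set.Ici 0) s| * ‖S s x‖) ^ 2 =
      γ ^ 2 * ∫ s in (0 : ℝ)..T, (Real.exp (-α * s) * Real.cosh (γ * s) * ‖S s x‖) ^ 2 := by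
    rw [← intervalIntegral.integral_const_mul]
    refine intervalIntegral.integral_congr fun s hs => ?_
    rw [Set.uIcc_of_le hT] at hs
    rw [hd s hs.1, abs_of_nonneg (by positivity)]
    ring
  have e2 : ∫ s in (0 : ℝ)..T, (Real.exp (-α * s) * |Real.sinh (γ * s)| * ‖S s x‖) ^ 2 =
      (∫ s in (0 : ℝ)..T, (Real.exp (-α * s) * Real.cosh (γ * s) * ‖S s x‖) ^ 2) -
        ∫ s in (0 : ℝ)..T, (Real.exp (-α * s) * ‖S s x‖) ^ 2 := by
    rw [← intervalIntegral.integral_sub i2 i3]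
    refine intervalIntegral.integral_congr fun s _ => ?_
    simp only [mul_pow, sq_abs, Real.sinh_sq]
    ring
  have h4 : (1 / 4) * ∫ s in (0 : ℝ)..T, (Real.exp (-(β - γ / 2) * s) * ‖S s x‖) ^ 2 ≤
      ∫ s in (0 : ℝ)..T, (Real.exp (-α * s) * Real.cosh (γ * s) * ‖S s x‖) ^ 2 := by
    rw [← intervalIntegral.integral_const_mul]
    refine intervalIntegral.integral_mono_on hT (i4.const_mul _) i2 fun s _ => ?_
    have hcosh : Real.exp (γ * s) / 2 ≤ Real.cosh (γ * s) := by
      rw [Real.cosh_eq]; linarith [Real.exp_pos (-(γ * s))]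
    have e : Real.exp (-(β - γ / 2) * s) = Real.exp (-α * s) * Real.exp (γ * s) := by
      rw [← Real.exp_add, hα]; ring_nf
    calc 1 / 4 * (Real.exp (-(β - γ / 2) * s) * ‖S s x‖) ^ 2
        = (Real.exp (-α * s) * (Real.exp (γ * s) / 2) * ‖S s x‖) ^ 2 := by rw [e]; ring
      _ ≤ _ := by gcongr
  have h3 : ∫ s in (0 : ℝ)..T, (Real.exp (-α * s) * ‖S s x‖) ^ 2 ≤ C ^ 2 * ‖x‖ ^ 2 * (1 / γ) := by
    refine le_trans ?_ (mul_le_mul_of_nonneg_left (integral_exp_neg_mul_le hγ T) (by positivity))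
    rw [← intervalIntegral.integral_const_mul]
    refine intervalIntegral.integral_mono_on hT i3
      (Continuous.intervalIntegrable (by fun_prop) _ _) fun s hs => ?_
    have e : Real.exp (-γ * s) = (Real.exp (-α * s) * Real.exp (β * s)) ^ 2 := by
      rw [← Real.exp_add, ← Real.exp_nat_mul, hα]; push_cast; ring_nf
    calc (Real.exp (-α * s) * ‖S s x‖) ^ 2
        ≤ (Real.exp (-α * s) * (C * Real.exp (β * s) * ‖x‖)) ^ 2 := by
          gcongr
          exact ContinuousLinearMap.le_of_opNorm_le _ (hg s hs.1) x
      _ = C ^ 2 * ‖x‖ ^ 2 * Real.exp (-γ * s) := by rw [e]; ring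
  rw [e1, e2] at main
  have hk : (1 / (2 * γ)) ^ 2 * (γ ^ 2 * ∫ s in (0 : ℝ)..T,
      (Real.exp (-α * s) * Real.cosh (γ * s) * ‖S s x‖) ^ 2) = (1 / 4) * ∫ s in (0 : ℝ)..T,
      (Real.exp (-α * s) * Real.cosh (γ * s) * ‖S s x‖) ^ 2 := by
    rw [← mul_assoc]
    congr 1
    field_simp
    norm_num
  rw [hk] at main
  -- The factor `16/3` inverts `¾ · ¼`, the second factor coming from `cosh² ≥ e^{2γs}/4`.
  have hfin : 16 * C ^ 2 / (3 * γ) * ‖x‖ ^ 2 = 16 / 3 * (C ^ 2 * ‖x‖ ^ 2 * (1 / γ)) := by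
    field_simp
  rw [hfin]
  linarith

/-- Passage from `L²` to pointwise: `‖S(T)x‖ ≤ M‖S(s)x‖` for `s ∈ [T - 1, T]`, so the integral over
this unit window controls `‖S(T)x‖`. The gain `γ/2` depends only on the resolvent bound, which
allows iteration. -/
theorem GrowthBound.exists_sub {S : ℝ → H →L[ℂ] H} (hS : IsC0Semigroup S) {m : ℝ → ℝ}
    (hm : DominatedBy S m) {C β ω γ : ℝ} (hγ : 0 < γ)
    (hR : ResolventEstimate S ω (1 / (2 * γ))) (hg : GrowthBound S C β) (hω : ω < β + γ / 2) :
    ∃ C', GrowthBound S C' (β - γ / 2) := by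
  obtain ⟨M, hM1, hM⟩ := hm.exists_bound 1
  set δ := β - γ / 2 with hδ
  set D := 16 * C ^ 2 / (3 * γ) with hD
  have hD0 : 0 ≤ D := by positivity
  refine ⟨M * Real.exp |δ| * (Real.sqrt D + 1), fun T hT => ?_⟩
  have hexp : ∀ s, T - 1 ≤ s → s ≤ T → 1 ≤ Real.exp |δ| * Real.exp (δ * T) * Real.exp (-δ * s) := by
    intro s h1 h2
    rw [← Real.exp_add, ← Real.exp_add]
    refine Real.one_le_exp ?_
    have : |δ * (T - s)| ≤ |δ| := by
      rw [abs_mul]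
      exact mul_le_of_le_one_right (abs_nonneg _) (abs_le.2 ⟨by linarith, by linarith⟩)
    have := (abs_le.1 this).1
    linarith
  -- For `T ≤ 1` the window does not fit in `[0, T]`; the local bound `M` suffices, and the `+ 1` in
  -- the constant accommodates it.
  rcases le_total T 1 with h | h
  · have h1 := hexp 0 (by linarith) hT
    rw [mul_zero, Real.exp_zero, mul_one] at h1
    have h2 : 1 ≤ Real.sqrt D + 1 := by linarith [Real.sqrt_nonneg D]
    calc ‖S T‖ ≤ M * 1 * 1 := by simpa using hM T hT h
      _ ≤ M * (Real.exp |δ| * Real.exp (δ * T)) * (Real.sqrt D + 1) := by gcongr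
      _ = _ := by ring
  · refine ContinuousLinearMap.opNorm_le_bound _ (by positivity) fun x => ?_
    have main := integral_weighted_sq_le_of_growthBound hS hγ hR hg hω x hT
    rw [← hδ, ← hD] at main
    set Q := Real.exp |δ| * Real.exp (δ * T) with hQ
    have hQ0 : 0 < Q := by positivity
    have hc : ContinuousOn (fun s => (Real.exp (-δ * s) * ‖S s x‖) ^ 2) (Set.Ici 0) := by
      have := hS.continuousOn_norm x
      fun_prop
    have hpt : ∀ s ∈ Set.Icc (T - 1) T,
        (‖S T x‖ / (M * Q)) ^ 2 ≤ (Real.exp (-δ * s) * ‖S s x‖) ^ 2 := by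
      intro s hs
      refine pow_le_pow_left₀ (by positivity) ?_ 2
      rw [div_le_iff₀ (by positivity)]
      have h1 : ‖S T x‖ ≤ M * ‖S s x‖ := by
        have e : S T x = S (T - s) (S s x) := by
          rw [← hS.apply_add (by linarith [hs.2]) (by linarith [hs.1]), sub_add_cancel]
        rw [e]
        exact ContinuousLinearMap.le_of_opNorm_le _
          (hM _ (by linarith [hs.2]) (by linarith [hs.1])) _
      calc ‖S T x‖ ≤ M * ‖S s x‖ * 1 := by rwa [mul_one]
        _ ≤ M * ‖S s x‖ * (Q * Real.exp (-δ * s)) := by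
          gcongr; exact hexp s hs.1 hs.2
        _ = _ := by ring
    have h2 : (‖S T x‖ / (M * Q)) ^ 2 ≤ D * ‖x‖ ^ 2 := by
      refine le_trans ?_ main
      have i1 : IntervalIntegrable (fun s => (Real.exp (-δ * s) * ‖S s x‖) ^ 2)
          MeasureTheory.volume 0 (T - 1) := (hc.mono fun s hs => by
            rw [Set.uIcc_of_le (by linarith)] at hs; exact hs.1).intervalIntegrable
      have i2 : IntervalIntegrable (fun s => (Real.exp (-δ * s) * ‖S s x‖) ^ 2)
          MeasureTheory.volume (T - 1) T := (hc.mono fun s hs => by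
            rw [Set.uIcc_of_le (by linarith)] at hs
            exact (by linarith : (0 : ℝ) ≤ T - 1).trans hs.1).intervalIntegrable
      rw [← intervalIntegral.integral_add_adjacent_intervals i1 i2]
      have p1 : 0 ≤ ∫ s in (0 : ℝ)..(T - 1), (Real.exp (-δ * s) * ‖S s x‖) ^ 2 :=
        intervalIntegral.integral_nonneg (by linarith) fun s _ => by positivity
      have p2 : ∫ _ in (T - 1)..T, (‖S T x‖ / (M * Q)) ^ 2 ≤
          ∫ s in (T - 1)..T, (Real.exp (-δ * s) * ‖S s x‖) ^ 2 :=
        intervalIntegral.integral_mono_on (by linarith) intervalIntegrable_const i2 hpt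
      rw [intervalIntegral.integral_const, sub_sub_cancel, one_smul] at p2
      linarith
    have h3 : ‖S T x‖ / (M * Q) ≤ Real.sqrt D * ‖x‖ := by
      refine abs_le_of_sq_le_sq' ?_ (by positivity) |>.2
      rwa [mul_pow, Real.sq_sqrt hD0]
    rw [div_le_iff₀ (by positivity)] at h3
    calc ‖S T x‖ ≤ Real.sqrt D * ‖x‖ * (M * Q) := h3
      _ ≤ (Real.sqrt D + 1) * ‖x‖ * (M * Q) := by gcongr; linarith
      _ = _ := by rw [hQ]; ring

/-- The **Gearhart–Prüss theorem**, in the form of a growth bound with exponent `ω`. -/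
theorem IsC0Semigroup.exists_growthBound_of_resolventEstimate {S : ℝ → H →L[ℂ] H}
    (hS : IsC0Semigroup S) {m : ℝ → ℝ} (hm : DominatedBy S m) {ω K : ℝ} (hK : 0 < K)
    (hR : ResolventEstimate S ω K) : ∃ C, GrowthBound S C ω := by
  obtain ⟨C₀, a, ha⟩ := hS.exists_growthBound hm
  set γ := 1 / (2 * K) with hγ
  have hγ0 : 0 < γ := by positivity
  have hR' : ResolventEstimate S ω (1 / (2 * γ)) := by
    have : 1 / (2 * γ) = K := by rw [hγ]; field_simp
    rwa [this]
  -- Each step lowers the exponent by `γ/2`; the maximum with `ω` keeps the condition `ω < β + γ/2`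
  -- valid throughout.
  have step : ∀ n : ℕ, ∃ C, GrowthBound S C (max (a - n * (γ / 2)) ω) := by
    intro n
    induction n with
    | zero => exact ⟨C₀, ha.mono (by simp)⟩
    | succ n ih =>
      obtain ⟨C, hC⟩ := ih
      have hlt : ω < max (a - n * (γ / 2)) ω + γ / 2 := by
        linarith [le_max_right (a - n * (γ / 2)) ω]
      obtain ⟨C', hC'⟩ := hC.exists_sub hS hm hγ0 hR' hlt
      refine ⟨C', hC'.mono ?_⟩
      rw [sub_le_iff_le_add]
      refine max_le ?_ ?_
      · have := le_max_left (a - (n + 1 : ℕ) * (γ / 2)) ω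
        push_cast at this ⊢
        linarith
      · have := le_max_right (a - (n + 1 : ℕ) * (γ / 2)) ω
        linarith
  obtain ⟨n, hn⟩ := exists_nat_ge ((a - ω) / (γ / 2))
  obtain ⟨C, hC⟩ := step n
  rw [div_le_iff₀ (by positivity)] at hn
  rw [max_eq_right (by linarith)] at hC
  exact ⟨C, hC⟩

/-- The growth bound permits every `α = ω + η` with `η > 0`. On `[0, T]` the weights for `α` and `ω`
differ by a factor between `e^{-ηT}` and `1`, which disappears as `η → 0`. -/
theorem integral_weighted_sq_le_of_resolventEstimate {S : ℝ → H →L[ℂ] H} (hS : IsC0Semigroup S)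
    {m : ℝ → ℝ} (hm : DominatedBy S m) {ω K : ℝ} (hK : 0 < K) (hR : ResolventEstimate S ω K)
    {Φ : ℝ → ℝ} (hΦ : ContDiffOn ℝ 1 Φ (Set.Ici 0)) (hΦ0 : Φ 0 = 0) (x : H) {T : ℝ}
    (hT : 0 ≤ T) :
    ∫ s in (0 : ℝ)..T, (Real.exp (-ω * s) * |Φ s| * ‖S s x‖) ^ 2 ≤
      K ^ 2 * ∫ s in (0 : ℝ)..T,
        (Real.exp (-ω * s) * |derivWithin Φ (Set.Ici 0) s| * ‖S s x‖) ^ 2 := by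
  obtain ⟨C, hg⟩ := hS.exists_growthBound_of_resolventEstimate hm hK hR
  have hsub : Set.uIcc 0 T ⊆ Set.Ici (0 : ℝ) := fun s hs => by
    rw [Set.uIcc_of_le hT] at hs; exact hs.1
  have hcS := (hS.continuousOn_norm x).mono hsub
  have hcΦ := hΦ.continuousOn.mono hsub
  have hcd := (continuousOn_derivWithin_Ici hΦ).mono hsub
  have hη : ∀ η > 0, Real.exp (-η * T) ^ 2 *
      (∫ s in (0 : ℝ)..T, (Real.exp (-ω * s) * |Φ s| * ‖S s x‖) ^ 2) ≤ K ^ 2 * ∫ s in (0 : ℝ)..T,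
        (Real.exp (-ω * s) * |derivWithin Φ (Set.Ici 0) s| * ‖S s x‖) ^ 2 := by
    intro η hη
    have main := integral_weighted_sq_le hS hK.le hR hg hΦ hΦ0 x (α := ω + η)
      (by linarith) (by linarith) hT
    have e : ∀ s, Real.exp (-(ω + η) * s) = Real.exp (-ω * s) * Real.exp (-η * s) := fun s => by
      rw [← Real.exp_add]; ring_nf
    refine le_trans ?_ (main.trans (mul_le_mul_of_nonneg_left ?_ (sq_nonneg K)))
    · rw [← intervalIntegral.integral_const_mul]
      refine intervalIntegral.integral_mono_on hT (ContinuousOn.intervalIntegrable (by fun_prop))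
        (ContinuousOn.intervalIntegrable (by fun_prop)) fun s hs => ?_
      rw [← mul_pow, e]
      have : Real.exp (-η * T) ≤ Real.exp (-η * s) := Real.exp_le_exp.2 (by nlinarith [hs.2])
      calc (Real.exp (-η * T) * (Real.exp (-ω * s) * |Φ s| * ‖S s x‖)) ^ 2
          ≤ (Real.exp (-η * s) * (Real.exp (-ω * s) * |Φ s| * ‖S s x‖)) ^ 2 := by gcongr
        _ = _ := by ring
    · refine intervalIntegral.integral_mono_on hT (ContinuousOn.intervalIntegrable (by fun_prop))
        (ContinuousOn.intervalIntegrable (by fun_prop)) fun s hs => ?_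
      have : Real.exp (-(ω + η) * s) ≤ Real.exp (-ω * s) :=
        Real.exp_le_exp.2 (by nlinarith [hs.1])
      gcongr
  have hlim : Tendsto (fun η : ℝ => Real.exp (-η * T) ^ 2 *
      ∫ s in (0 : ℝ)..T, (Real.exp (-ω * s) * |Φ s| * ‖S s x‖) ^ 2) (𝓝[>] 0)
      (𝓝 (∫ s in (0 : ℝ)..T, (Real.exp (-ω * s) * |Φ s| * ‖S s x‖) ^ 2)) := by
    have hc : Continuous fun η : ℝ => Real.exp (-η * T) ^ 2 *
      ∫ s in (0 : ℝ)..T, (Real.exp (-ω * s) * |Φ s| * ‖S s x‖) ^ 2 := by fun_prop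
    have := (hc.tendsto 0).mono_left (nhdsWithin_le_nhds (s := Set.Ioi 0))
    simpa using this
  exact le_of_tendsto hlim (eventually_mem_nhdsWithin.mono hη)

end Growth

end GearhartPruss

/-! ### Positive and negative parts, Cauchy–Schwarz and the final estimate. -/

namespace GearhartPruss

open MeasureTheory
open scoped InnerProductSpace

theorem PM.part_nonneg (ε : PM) (a : ℝ) : 0 ≤ ε.part a := by
  cases ε <;> exact le_max_right _ _

theorem PM.continuous_part (ε : PM) : Continuous ε.part := by
  cases ε
  · exact continuous_id.max continuous_const
  · exact continuous_neg.max continuous_const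

theorem PM.part_plus_eq (a : ℝ) : PM.plus.part a = a + PM.minus.part a := by
  simp only [PM.part]
  rcases le_total a 0 with h | h
  · rw [max_eq_right h, max_eq_left (by linarith)]; ring
  · rw [max_eq_left h, max_eq_right (by linarith)]; ring

/-- Cauchy–Schwarz for interval integrals of continuous functions. -/
theorem integral_mul_le_mul_of_integral_sq_le {f g : ℝ → ℝ} {t A B : ℝ} (ht : 0 ≤ t)
    (hf : ContinuousOn f (Set.Icc 0 t)) (hg : ContinuousOn g (Set.Icc 0 t))
    (hA : 0 ≤ A) (hB : 0 ≤ B) (hfA : ∫ s in (0 : ℝ)..t, f s ^ 2 ≤ A ^ 2)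
    (hgB : ∫ s in (0 : ℝ)..t, g s ^ 2 ≤ B ^ 2) :
    ∫ s in (0 : ℝ)..t, f s * g s ≤ A * B := by
  -- Enlarging both bounds by `η` makes them positive, so the optimal weights `b/(2a)` and `a/(2b)`
  -- in Young's inequality are defined.
  have hη : ∀ η > 0, ∫ s in (0 : ℝ)..t, f s * g s ≤ (A + η) * (B + η) := by
    intro η hη
    set a := A + η
    set b := B + η
    have ha : 0 < a := by positivity
    have hb : 0 < b := by positivity
    have hfa : ∫ s in (0 : ℝ)..t, f s ^ 2 ≤ a ^ 2 :=
      hfA.trans (pow_le_pow_left₀ hA (by linarith) 2)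
    have hgb : ∫ s in (0 : ℝ)..t, g s ^ 2 ≤ b ^ 2 :=
      hgB.trans (pow_le_pow_left₀ hB (by linarith) 2)
    have if2 : IntervalIntegrable (fun s => f s ^ 2) volume 0 t :=
      (hf.pow 2).intervalIntegrable_of_Icc ht
    have ig2 : IntervalIntegrable (fun s => g s ^ 2) volume 0 t :=
      (hg.pow 2).intervalIntegrable_of_Icc ht
    calc ∫ s in (0 : ℝ)..t, f s * g s
        ≤ ∫ s in (0 : ℝ)..t, (b / (2 * a) * f s ^ 2 + a / (2 * b) * g s ^ 2) := by
          refine intervalIntegral.integral_mono_on ht ((hf.mul hg).intervalIntegrable_of_Icc ht)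
            ((if2.const_mul _).add (ig2.const_mul _)) fun s _ => ?_
          have : b / (2 * a) * f s ^ 2 + a / (2 * b) * g s ^ 2 - f s * g s =
              (b * f s - a * g s) ^ 2 / (2 * a * b) := by
            field_simp; ring
          have h0 : 0 ≤ (b * f s - a * g s) ^ 2 / (2 * a * b) := by positivity
          linarith
      _ = b / (2 * a) * (∫ s in (0 : ℝ)..t, f s ^ 2) +
            a / (2 * b) * ∫ s in (0 : ℝ)..t, g s ^ 2 := by
          rw [intervalIntegral.integral_add (if2.const_mul _) (ig2.const_mul _),
            intervalIntegral.integral_const_mul, intervalIntegral.integral_const_mul]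
      _ ≤ b / (2 * a) * a ^ 2 + a / (2 * b) * b ^ 2 := by gcongr
      _ = a * b := by field_simp; ring
  have hc : Continuous fun η : ℝ => (A + η) * (B + η) := by fun_prop
  have hlim := (hc.tendsto 0).mono_left (nhdsWithin_le_nhds (s := Set.Ioi 0))
  rw [add_zero, add_zero] at hlim
  exact ge_of_tendsto hlim (eventually_mem_nhdsWithin.mono hη)

theorem weightedL2Norm_sq {ω t : ℝ} (ht : 0 ≤ t) (f : ℝ → ℝ) :
    weightedL2Norm ω t f ^ 2 = ∫ s in (0 : ℝ)..t, (Real.exp (-ω * s) * f s) ^ 2 := by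
  rw [weightedL2Norm, Real.sq_sqrt (integral_nonneg fun s => by positivity),
    intervalIntegral.integral_of_le ht, integral_Ico_eq_integral_Ioo,
    integral_Ioc_eq_integral_Ioo]

variable {H : Type*} [NormedAddCommGroup H] [InnerProductSpace ℂ H] [CompleteSpace H]

/-- Both the positive and the negative part of `r² Φ² - Φ'²`, integrated against the orbit of `x`,
are controlled by the negative part integrated against `m`. -/
theorem integral_part_mul_orbit_sq_le {S : ℝ → H →L[ℂ] H} (hS : IsC0Semigroup S) {m : ℝ → ℝ}
    (hm : DominatedBy S m) {ω r : ℝ} (hr : 0 < r) (hR : ResolventEstimate S ω r⁻¹)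
    {Φ : ℝ → ℝ} (hΦ : IsAdmissible Φ) (ε : PM) {t : ℝ} (ht : 0 ≤ t) (x : H) :
    ∫ s in (0 : ℝ)..t, (Real.sqrt (ε.part (r ^ 2 * Φ s ^ 2 - halfLineDeriv Φ s ^ 2)) *
        (Real.exp (-ω * s) * ‖S s x‖)) ^ 2 ≤
      (weightedL2Norm ω t (fun s => Real.sqrt
        (PM.minus.part (r ^ 2 * Φ s ^ 2 - halfLineDeriv Φ s ^ 2)) * m s) * ‖x‖) ^ 2 := by
  have hsub : Set.Icc 0 t ⊆ Set.Ici (0 : ℝ) := Set.Icc_subset_Ici_self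
  have hcS := (hS.continuousOn_norm x).mono hsub
  have hcΦ := hΦ.contDiffOn.continuousOn.mono hsub
  have hcd : ContinuousOn (halfLineDeriv Φ) (Set.Icc 0 t) :=
    (continuousOn_derivWithin_Ici hΦ.contDiffOn).mono hsub
  have hcm := hm.1.mono hsub
  set a : ℝ → ℝ := fun s => r ^ 2 * Φ s ^ 2 - halfLineDeriv Φ s ^ 2 with ha
  have hca : ContinuousOn a (Set.Icc 0 t) := by fun_prop
  have hcp : ∀ ε : PM, ContinuousOn (fun s => ε.part (a s)) (Set.Icc 0 t) := fun ε =>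
    ε.continuous_part.comp_continuousOn hca
  have hcm' := hcp .minus
  set E : ℝ → ℝ := fun s => (Real.exp (-ω * s) * ‖S s x‖) ^ 2 with hE
  have hcE : ContinuousOn E (Set.Icc 0 t) := by fun_prop
  -- The weighted estimate with `K = 1/r`, multiplied by `r²`.
  have key : ∫ s in (0 : ℝ)..t, a s * E s ≤ 0 := by
    have h := integral_weighted_sq_le_of_resolventEstimate hS hm (inv_pos.2 hr) hR
      hΦ.contDiffOn hΦ.map_zero x ht
    have e : ∫ s in (0 : ℝ)..t, a s * E s =
        r ^ 2 * (∫ s in (0 : ℝ)..t, (Real.exp (-ω * s) * |Φ s| * ‖S s x‖) ^ 2) -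
        ∫ s in (0 : ℝ)..t,
          (Real.exp (-ω * s) * |derivWithin Φ (Set.Ici 0) s| * ‖S s x‖) ^ 2 := by
      rw [← intervalIntegral.integral_const_mul, ← intervalIntegral.integral_sub]
      · refine intervalIntegral.integral_congr fun s _ => ?_
        simp only [ha, hE, mul_pow, sq_abs, halfLineDeriv]
        ring
      · exact ContinuousOn.intervalIntegrable_of_Icc ht (by fun_prop)
      · have hcd' : ContinuousOn (derivWithin Φ (Set.Ici 0)) (Set.Icc 0 t) := hcd
        exact ContinuousOn.intervalIntegrable_of_Icc ht (by fun_prop)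
    rw [e]
    have := mul_le_mul_of_nonneg_left h (sq_nonneg r)
    rw [← mul_assoc, ← mul_pow, mul_inv_cancel₀ hr.ne', one_pow, one_mul] at this
    linarith
  have hminus : ∫ s in (0 : ℝ)..t, PM.minus.part (a s) * E s ≤
      (weightedL2Norm ω t (fun s => Real.sqrt (PM.minus.part (a s)) * m s) * ‖x‖) ^ 2 := by
    rw [mul_pow, weightedL2Norm_sq ht, ← intervalIntegral.integral_mul_const]
    refine intervalIntegral.integral_mono_on ht
      (ContinuousOn.intervalIntegrable_of_Icc ht (by fun_prop))
      (ContinuousOn.intervalIntegrable_of_Icc ht (by fun_prop)) fun s hs => ?_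
    have hp := PM.minus.part_nonneg (a s)
    calc PM.minus.part (a s) * E s
        ≤ PM.minus.part (a s) * (Real.exp (-ω * s) * (m s * ‖x‖)) ^ 2 := by
          have := ContinuousLinearMap.le_of_opNorm_le _ (hm.2 s hs.1) x
          simp only [hE]
          gcongr
      _ = Real.sqrt (PM.minus.part (a s)) ^ 2 * (Real.exp (-ω * s) * (m s * ‖x‖)) ^ 2 := by
          rw [Real.sq_sqrt hp]
      _ = _ := by ring
  -- For the sign `+`, `a₊ = a + a₋` and `key` removes the contribution of `a`.
  have hε : ∫ s in (0 : ℝ)..t, ε.part (a s) * E s ≤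
      ∫ s in (0 : ℝ)..t, PM.minus.part (a s) * E s := by
    cases ε
    · have e : ∫ s in (0 : ℝ)..t, PM.plus.part (a s) * E s =
          (∫ s in (0 : ℝ)..t, a s * E s) + ∫ s in (0 : ℝ)..t, PM.minus.part (a s) * E s := by
        rw [← intervalIntegral.integral_add
          (ContinuousOn.intervalIntegrable_of_Icc ht (by fun_prop))
          (ContinuousOn.intervalIntegrable_of_Icc ht (by fun_prop))]
        refine intervalIntegral.integral_congr fun s _ => ?_
        simp only [PM.part_plus_eq]
        ring
      linarith
    · exact le_rfl
  refine le_trans (le_of_eq ?_) (hε.trans hminus)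
  refine intervalIntegral.integral_congr fun s _ => ?_
  simp only [mul_pow (Real.sqrt _), hE, Real.sq_sqrt (ε.part_nonneg _)]
  rfl

end GearhartPruss

theorem theorem1p2 {H : Type*} [NormedAddCommGroup H] [InnerProductSpace ℂ H] [CompleteSpace H]
    (S : ℝ → H →L[ℂ] H) (hS : GearhartPruss.IsC0Semigroup S)
    (ω : ℝ) (hω : GearhartPruss.ResolventBoundedRightOf (GearhartPruss.generator S) ω)
    (r : ℝ) (hr : r = GearhartPruss.resolventRadius (GearhartPruss.generator S) ω)
    (m : ℝ → ℝ) (hm_cont : ContinuousOn m (Set.Ici 0)) (hm_pos : ∀ t, 0 ≤ t → 0 < m t)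
    (hm : ∀ t, 0 ≤ t → ‖S t‖ ≤ m t)
    (Φ Ψ dΦ dΨ : ℝ → ℝ)
    (hΦ : GearhartPruss.IsAdmissible Φ) (hΨ : GearhartPruss.IsAdmissible Ψ)
    (hdΦ : dΦ = GearhartPruss.halfLineDeriv Φ) (hdΨ : dΨ = GearhartPruss.halfLineDeriv Ψ)
    (ε₁ ε₂ : GearhartPruss.PM) (t : ℝ) (ht : 0 < t) (D : ℝ)
    (hD : D = ∫ s in (0 : ℝ)..t,
      Real.sqrt (ε₁.part (r ^ 2 * Φ s ^ 2 - dΦ s ^ 2)) *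
        Real.sqrt (ε₂.part (r ^ 2 * GearhartPruss.reflect t Ψ s ^ 2
          - GearhartPruss.reflect t dΨ s ^ 2)))
    (hD_pos : 0 < D) :
    ‖S t‖ ≤ Real.exp (ω * t) *
      (GearhartPruss.weightedL2Norm ω t
          (fun s => Real.sqrt (GearhartPruss.PM.minus.part (r ^ 2 * Φ s ^ 2 - dΦ s ^ 2)) * m s) *
        GearhartPruss.weightedL2Norm ω t
          (fun s => Real.sqrt (GearhartPruss.PM.minus.part (r ^ 2 * Ψ s ^ 2 - dΨ s ^ 2)) * m s)) /
      D := by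
  open GearhartPruss MeasureTheory InnerProductSpace in
  subst hdΦ hdΨ
  set A := weightedL2Norm ω t (fun s => Real.sqrt
    (PM.minus.part (r ^ 2 * Φ s ^ 2 - halfLineDeriv Φ s ^ 2)) * m s) with hA
  set B := weightedL2Norm ω t (fun s => Real.sqrt
    (PM.minus.part (r ^ 2 * Ψ s ^ 2 - halfLineDeriv Ψ s ^ 2)) * m s) with hB
  have hA0 : 0 ≤ A := Real.sqrt_nonneg _
  have hB0 : 0 ≤ B := Real.sqrt_nonneg _
  -- The zero space is settled separately; positivity of `r` needs a nonzero vector.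
  rcases subsingleton_or_nontrivial H with hH | hH
  · rw [Subsingleton.elim (S t) 0, norm_zero]
    positivity
  have hr0 : 0 < r := hr ▸ resolventRadius_pos hω
  have hK : ∀ z : ℂ, ω < z.re → ‖resolvent (generator S) z‖ ≤ r⁻¹ := fun z hz => by
    rw [hr, resolventRadius, inv_inv]
    exact norm_resolvent_le_sSup hω hz
  have hdom : DominatedBy S m := ⟨hm_cont, hm⟩
  have hS' := hS.adjointSemigroup hdom
  refine ContinuousLinearMap.opNorm_le_bound _ (by positivity) fun x => ?_
  set y := S t x with hy
  set T := adjointSemigroup S with hT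
  set f : ℝ → ℝ := fun s => Real.sqrt (ε₁.part (r ^ 2 * Φ s ^ 2 - halfLineDeriv Φ s ^ 2)) *
    (Real.exp (-ω * s) * ‖S s x‖) with hf
  set g : ℝ → ℝ := fun s => Real.sqrt (ε₂.part (r ^ 2 * Ψ s ^ 2 - halfLineDeriv Ψ s ^ 2)) *
    (Real.exp (-ω * s) * ‖T s y‖) with hg
  have hsub : Set.Icc 0 t ⊆ Set.Ici (0 : ℝ) := Set.Icc_subset_Ici_self
  have hweight : ∀ (ε : PM) {Φ : ℝ → ℝ}, IsAdmissible Φ → ContinuousOn (fun s =>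
      Real.sqrt (ε.part (r ^ 2 * Φ s ^ 2 - halfLineDeriv Φ s ^ 2))) (Set.Icc 0 t) := by
    intro ε Φ hΦ
    have h1 := hΦ.contDiffOn.continuousOn.mono hsub
    have h2 : ContinuousOn (halfLineDeriv Φ) (Set.Icc 0 t) :=
      (continuousOn_derivWithin_Ici hΦ.contDiffOn).mono hsub
    have h3 : ContinuousOn (fun s => r ^ 2 * Φ s ^ 2 - halfLineDeriv Φ s ^ 2) (Set.Icc 0 t) := by
      fun_prop
    exact (ε.continuous_part.comp_continuousOn h3).sqrt
  have hmaps : Set.MapsTo (fun s : ℝ => t - s) (Set.Icc 0 t) (Set.Icc 0 t) := fun s hs =>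
    ⟨by linarith [hs.2], by linarith [hs.1]⟩
  have hwΦ := hweight ε₁ hΦ
  have hwΨ := hweight ε₂ hΨ
  have hwΨ' : ContinuousOn (fun s => Real.sqrt (ε₂.part (r ^ 2 * reflect t Ψ s ^ 2 -
      reflect t (halfLineDeriv Ψ) s ^ 2))) (Set.Icc 0 t) :=
    hwΨ.comp (by fun_prop) hmaps
  have hcS := (hS.continuousOn_norm x).mono hsub
  have hcT := (hS'.continuousOn_norm y).mono hsub
  have hcf : ContinuousOn f (Set.Icc 0 t) := by fun_prop
  have hcg : ContinuousOn g (Set.Icc 0 t) := by fun_prop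
  have hcg' : ContinuousOn (fun s => g (t - s)) (Set.Icc 0 t) := hcg.comp (by fun_prop) hmaps
  have hf2 : ∫ s in (0 : ℝ)..t, f s ^ 2 ≤ (A * ‖x‖) ^ 2 :=
    integral_part_mul_orbit_sq_le hS hdom hr0 (resolventEstimate_of_norm_resolvent_le hω hK) hΦ ε₁
      ht.le x
  have hg2 : ∫ s in (0 : ℝ)..t, g (t - s) ^ 2 ≤ (B * ‖y‖) ^ 2 := by
    rw [intervalIntegral.integral_comp_sub_left (fun s => g s ^ 2), sub_self, sub_zero]
    exact integral_part_mul_orbit_sq_le hS' hdom.adjointSemigroup hr0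
      (resolventEstimate_adjointSemigroup hω hK) hΨ ε₂ ht.le y
  have hCS := integral_mul_le_mul_of_integral_sq_le ht.le hcf hcg' (by positivity)
    (by positivity) hf2 hg2
  -- `⟨S(s)x, S(t-s)*y⟩ = ⟨S(t)x, y⟩ = ‖y‖²` does not depend on `s`.
  have hpair : ∀ s ∈ Set.Icc 0 t, ‖y‖ ^ 2 ≤ ‖S s x‖ * ‖T (t - s) y‖ := by
    intro s hs
    have e : ⟪S s x, T (t - s) y⟫_ℂ = ⟪y, y⟫_ℂ := by
      rw [hT, adjointSemigroup, ContinuousLinearMap.adjoint_inner_right,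
        ← hS.apply_add (by linarith [hs.2]) hs.1, sub_add_cancel]
    have := norm_inner_le_norm (𝕜 := ℂ) (S s x) (T (t - s) y)
    rw [e, inner_self_eq_norm_sq_to_K] at this
    simpa using this
  -- The exponential weights at `s` and `t - s` multiply to the constant `e^{-ωt}`, so integrating
  -- `hpair` against the weights produces exactly `D`.
  have hmain : D * (Real.exp (-ω * t) * ‖y‖ ^ 2) ≤ ∫ s in (0 : ℝ)..t, f s * g (t - s) := by
    rw [hD, ← intervalIntegral.integral_mul_const]
    refine intervalIntegral.integral_mono_on ht.le
      (ContinuousOn.intervalIntegrable_of_Icc ht.le (by fun_prop))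
      (ContinuousOn.intervalIntegrable_of_Icc ht.le (by fun_prop)) fun s hs => ?_
    have e : Real.exp (-ω * t) = Real.exp (-ω * s) * Real.exp (-ω * (t - s)) := by
      rw [← Real.exp_add]; ring_nf
    simp only [hf, hg, reflect]
    rw [e]
    set p := Real.sqrt (ε₁.part (r ^ 2 * Φ s ^ 2 - halfLineDeriv Φ s ^ 2))
    set q := Real.sqrt (ε₂.part (r ^ 2 * Ψ (t - s) ^ 2 - halfLineDeriv Ψ (t - s) ^ 2))
    calc p * q * (Real.exp (-ω * s) * Real.exp (-ω * (t - s)) * ‖y‖ ^ 2)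
        ≤ p * q * (Real.exp (-ω * s) * Real.exp (-ω * (t - s)) *
            (‖S s x‖ * ‖T (t - s) y‖)) := by
          gcongr
          exact hpair s hs
      _ = _ := by ring
  have hfin : D * (Real.exp (-ω * t) * ‖y‖ ^ 2) ≤ A * ‖x‖ * (B * ‖y‖) := hmain.trans hCS
  have hexp : Real.exp (ω * t) * Real.exp (-ω * t) = 1 := by
    rw [← Real.exp_add]; simp
  rcases (norm_nonneg y).eq_or_lt with h0 | h0
  · rw [← h0]; positivity
  · have h1 : D * ‖y‖ ≤ Real.exp (ω * t) * (A * B) * ‖x‖ := by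
      have h2 : Real.exp (ω * t) * (D * (Real.exp (-ω * t) * ‖y‖ ^ 2)) ≤
          Real.exp (ω * t) * (A * ‖x‖ * (B * ‖y‖)) :=
        mul_le_mul_of_nonneg_left hfin (Real.exp_nonneg _)
      refine le_of_mul_le_mul_right ?_ h0
      calc D * ‖y‖ * ‖y‖ = Real.exp (ω * t) * (D * (Real.exp (-ω * t) * ‖y‖ ^ 2)) := by
            linear_combination (-D * ‖y‖ ^ 2) * hexp
        _ ≤ _ := h2
        _ = _ := by ring
    rw [div_mul_eq_mul_div, le_div_iff₀ hD_pos]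
    linarith
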